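/- **Setting.** Fix $\tau\in(2,3)$ and $h_{\min}>0$. In the hidden-variable model on $n$ vertices, every vertex independently receives a hidden variable $h$ with density $\rho(h)=Ch^{-\tau}$ for $h\ge h_{\min}$ ($C$ the normalizing constant), whose mean is denoted by $\mu$. Conditionally on all hidden variables, each pair of vertices, with hidden variables $h,h'$, is joined independently with probability $\min\left(\frac{hh'}{\mu n},1\right)$. Let $H=(V_H,E_H)$ be a simple graph (a motif) on $k$ vertices. Let $N(H)$ be the number of labelled, not necessarily induced, copies of $H$ in the model, i.e. of injective maps from $V_H$ to the $n$ vertices that send edges to edges. Let $P(H)=\mathbb{E}\Big[\prod_{\{i,j\}\in E_H}\min\left(\frac{h_ih_j}{\mu n},1\right)\Big]$, with $h_1,\dots,h_k$ i.i.d. of density $\rho$, be the probability that $H$ is present on $k$ given vertices. For $\alpha\in\mathbb{R}^{V_H}$ and $\varepsilon\in(0,1)$, let $N(H,\alpha,\varepsilon)$ be the number of those copies in which, for every $i\in V_H$, the vertex playing the role of $i$ has its hidden variable in $[\varepsilon n^{\alpha_i},\varepsilon^{-1}n^{\alpha_i}]$. Put $$B_f(H)=\max\left[|S_1|-|S_2|-\frac{2E_{S_1}+E_{S_1,S_3}}{\tau-1}\right],$$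 the maximum being over all partitions of $V_H$ into three (possibly empty) classes $S_1,S_2,S_3$, where $E_{S_1}$ is the number of edges of $H$ inside $S_1$ and $E_{S_1,S_3}$ the number of edges of $H$ between $S_1$ and $S_3$. **Theorem.** Suppose that the maximum is attained by exactly one partition $(S_1,S_2,S_3)$, and put $\alpha^*_i=0$ for $i\in S_1$, $\alpha^*_i=1$ for $i\in S_2$ and $\alpha^*_i=\frac12$ for $i\in S_3$. Let $e=\frac{3-\tau}{2}k+\frac{\tau-1}{2}B_f(H)$. Call $\varepsilon\in(0,1)$ admissible if $S_1=\emptyset$ or $h_{\min}<1/\varepsilon$. Then, as $n\to\infty$: 1. $\mathbb{E}[N(H)]\sim n^kP(H)$ and $\mathbb{E}[N(H)]=\Theta(n^{e})$. 2. There are constants $c,C>0$ and a function $f$, none depending on $n$, such that for every admissible $\varepsilon$ one has $f(\varepsilon)>0$ and, for all sufficiently large $n$, $c\,f(\varepsilon)\le \mathbb{E}[N(H,\alpha^*,\varepsilon)]/n^{e}\le C\,f(\varepsilon)$. 3. For every $\alpha\ne\alpha^*$ there is $\eta>0$ such that $\mathbb{E}[N(H,\alpha,\varepsilon)]/\mathbb{E}[N(H,\alpha^*,\varepsilon)]=O(n^{-\eta})$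 for every admissible $\varepsilon$. 4. For every $\delta>0$ there is $\varepsilon_0\in(0,1)$ such that for every $\varepsilon\in(0,\varepsilon_0)$ and all sufficiently large $n$, $\mathbb{E}[N(H,\alpha^*,\varepsilon)]\ge(1-\delta)\,\mathbb{E}[N(H)]$. -/

import Mathlib

open MeasureTheory Filter Asymptotics

noncomputable section

namespace HiddenVariable

/-! ### The partition optimization problem -/

/-- Labels of the three classes of a partition of the vertices of a motif. -/
inductive Part : Type
  | S1
  | S2
  | S3

/-- A partition of the vertices of a motif on `k` vertices into classes `S₁, S₂, S₃`
(classes may be empty). -/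
abbrev VertexPartition (k : ℕ) : Type := Fin k → Part

open Classical in
/-- `|S|`: the number of vertices in the class labelled `s`. -/
def classSize {k : ℕ} (P : VertexPartition k) (s : Part) : ℕ :=
  (Finset.univ.filter fun i => P i = s).card

open Classical in
/-- `E_S`: the number of edges of `H` inside the class labelled `s`. -/
def edgesInside {k : ℕ} (H : SimpleGraph (Fin k)) (P : VertexPartition k) (s : Part) : ℕ :=
  (Finset.univ.filter fun q : Fin k × Fin k =>
    q.1 < q.2 ∧ H.Adj q.1 q.2 ∧ P q.1 = s ∧ P q.2 = s).card

open Classical in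
/-- `E_{S,T}`: the number of edges of `H` between two different classes `s` and `t`;
each such edge is listed once, with its `s`-end first. -/
def edgesBetween {k : ℕ} (H : SimpleGraph (Fin k)) (P : VertexPartition k) (s t : Part) : ℕ :=
  (Finset.univ.filter fun q : Fin k × Fin k =>
    H.Adj q.1 q.2 ∧ P q.1 = s ∧ P q.2 = t).card

/-- The objective `|S₁| - |S₂| - (2 E_{S₁} + E_{S₁,S₃}) / (τ - 1)`. -/
def objective (τ : ℝ) {k : ℕ} (H : SimpleGraph (Fin k)) (P : VertexPartition k) : ℝ :=
  (classSize P .S1 : ℝ) - (classSize P .S2 : ℝ)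
    - (2 * (edgesInside H P .S1 : ℝ) + (edgesBetween H P .S1 .S3 : ℝ)) / (τ - 1)

/-- `B_f(H)`: the maximum of the objective over the (finitely many) partitions. -/
def Bf (τ : ℝ) {k : ℕ} (H : SimpleGraph (Fin k)) : ℝ :=
  ⨆ P : VertexPartition k, objective τ H P

/-- `P` attains the maximum of the objective. -/
def IsOptimal (τ : ℝ) {k : ℕ} (H : SimpleGraph (Fin k)) (P : VertexPartition k) : Prop :=
  ∀ Q : VertexPartition k, objective τ H Q ≤ objective τ H P

/-- The exponent of a class: `0` on `S₁`, `1` on `S₂`, `1/2` on `S₃`. -/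
def Part.exponent : Part → ℝ
  | .S1 => 0
  | .S2 => 1
  | .S3 => 1 / 2

/-- The degree profile `α` attached to a partition. -/
def profile {k : ℕ} (P : VertexPartition k) : Fin k → ℝ := fun i => (P i).exponent

/-! ### The hidden-variable model -/

/-- The law of one hidden variable, with density `C h^{-τ}` on `h ≥ hmin`
(a Pareto law of shape `τ - 1`, so `C = (τ - 1) hmin^{τ - 1}`). -/
def hiddenLaw (τ hmin : ℝ) : Measure ℝ :=
  ProbabilityTheory.paretoMeasure hmin (τ - 1)

/-- `μ`: the mean of the hidden variables. -/
def meanHidden (τ hmin : ℝ) : ℝ := ∫ x, x ∂(hiddenLaw τ hmin)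

/-- The connection probability `min (h h' / (μ n)) 1`. -/
def connProb (τ hmin : ℝ) (n : ℕ) (h h' : ℝ) : ℝ :=
  min (h * h' / (meanHidden τ hmin * n)) 1

lemma connProb_comm (τ hmin : ℝ) (n : ℕ) (h h' : ℝ) :
    connProb τ hmin n h h' = connProb τ hmin n h' h := by
  unfold connProb
  rw [mul_comm h h']

/-- The sample space on `n` vertices: one hidden variable per vertex, and one number in `[0,1]`
per unordered pair of vertices (the coordinates of the diagonal pairs are not used). -/
abbrev Sample (n : ℕ) : Type := (Fin n → ℝ) × (Sym2 (Fin n) → unitInterval)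

/-- The probability on the sample space: the hidden variables are i.i.d. with law `hiddenLaw`,
and independently of them the numbers attached to the pairs are i.i.d. uniform on `[0,1]`. -/
def modelMeasure (τ hmin : ℝ) (n : ℕ) : Measure (Sample n) :=
  (Measure.pi fun _ : Fin n => hiddenLaw τ hmin).prod
    (Measure.pi fun _ : Sym2 (Fin n) => (volume : Measure unitInterval))

/-- The random graph: the pair `{i, j}` is joined when its uniform number is at most
the connection probability of `h i` and `h j`. Thus, conditionally on all the hidden variables,
the pairs are joined independently, each with its connection probability. -/
def modelGraph (τ hmin : ℝ) (n : ℕ) (ω : Sample n) : SimpleGraph (Fin n) where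
  Adj i j := i ≠ j ∧ (ω.2 s(i, j) : ℝ) ≤ connProb τ hmin n (ω.1 i) (ω.1 j)
  symm := ⟨fun i j hij => ⟨hij.1.symm, by
    rw [Sym2.eq_swap, connProb_comm]; exact hij.2⟩⟩
  loopless := ⟨fun _ hi => hi.1 rfl⟩

/-! ### Motif counts -/

/-- `E[N(H)]`, where `N(H)` is the number of (labelled, not necessarily induced) copies of `H`
in the random graph on `n` vertices. -/
def expCount (τ hmin : ℝ) {k : ℕ} (H : SimpleGraph (Fin k)) (n : ℕ) : ℝ :=
  ∫ ω, ((modelGraph τ hmin n ω).labelledCopyCount H : ℝ) ∂(modelMeasure τ hmin n)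

/-- `N(H, α, ε)`: the number of labelled copies of `H` in which, for every vertex `i` of `H`,
the vertex playing the role of `i` has its hidden variable in `[ε, 1/ε] n^{α i}`. -/
def windowCount (τ hmin : ℝ) {k : ℕ} (H : SimpleGraph (Fin k)) (α : Fin k → ℝ) (ε : ℝ)
    (n : ℕ) (ω : Sample n) : ℕ :=
  Nat.card {f : H.Copy (modelGraph τ hmin n ω) //
    ∀ i, ω.1 (f i) ∈ Set.Icc (ε * (n : ℝ) ^ α i) (1 / ε * (n : ℝ) ^ α i)}

/-- `E[N(H, α, ε)]`. -/
def expWindowCount (τ hmin : ℝ) {k : ℕ} (H : SimpleGraph (Fin k)) (α : Fin k → ℝ) (ε : ℝ)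
    (n : ℕ) : ℝ :=
  ∫ ω, (windowCount τ hmin H α ε n ω : ℝ) ∂(modelMeasure τ hmin n)

open Classical in
/-- `P(H)`: the probability that `H` is present on `k` vertices with i.i.d. hidden variables
`h₁, …, h_k`, as the integral of the product of the connection probabilities of the edges. -/
def motifProb (τ hmin : ℝ) {k : ℕ} (H : SimpleGraph (Fin k)) (n : ℕ) : ℝ :=
  ∫ h : Fin k → ℝ,
    ∏ q ∈ Finset.univ.filter (fun q : Fin k × Fin k => q.1 < q.2 ∧ H.Adj q.1 q.2),
      connProb τ hmin n (h q.1) (h q.2)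
    ∂(Measure.pi fun _ : Fin k => hiddenLaw τ hmin)

/-- The growth exponent `(3 - τ) k / 2 + (τ - 1) B_f(H) / 2`. -/
def growthExponent (τ : ℝ) {k : ℕ} (H : SimpleGraph (Fin k)) : ℝ :=
  (3 - τ) / 2 * k + (τ - 1) / 2 * Bf τ H

/-- The parameters `ε ∈ (0,1)`; when `S₁` is nonempty, the constant-order window `[ε, 1/ε]` is
also required to reach above the minimal hidden variable. -/
def Admissible (hmin : ℝ) {k : ℕ} (P : VertexPartition k) (ε : ℝ) : Prop :=
  0 < ε ∧ ε < 1 ∧ ((∃ i, P i = .S1) → hmin < 1 / ε)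

end HiddenVariable

end

/-! Write `y i = log (h i) - log (μ n) / 2`. An edge then has weight `exp (min (y i + y j) 0)`, and
the power-law density, with the Jacobian of the logarithm, contributes `exp (-(τ - 1) y i)` per
vertex up to factors free of `h`. The logarithm of the integrand of `P(H)` is thus, up to an
additive constant, the piecewise linear function `logWeight`, on the region `y i ≥ -L`, where `L` is
`log n / 2` plus a constant because of the cutoff `hmin`. At the sign vector of a partition (`-1` on
`S₁`, `1` on `S₂`, `0` on `S₃`), `logWeight` is `τ - 1` times the objective.

The partitions suffice because of a layer-cake formula. At a threshold `θ ≥ 0`, put a vertex in `S₂`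
if `y > θ`, in `S₁` if `y < -θ`, and in `S₃` otherwise. Integrating the signs over `θ` recovers `y`,
and integrating the edge terms recovers `min (y + z) 0`, so `logWeight y` is the integral of its
values at threshold partitions (`logWeight_integral`). Thresholds below `L` contribute at most the
optimum, with a fixed loss unless the partition is `P`; above `L` there is no `S₁`, and every vertex
of `S₂` costs `τ - 1`. Hence `logWeight` falls off linearly in the `ℓ¹` distance from `L` times the
signs of `P` (`exists_logWeight_le`).

Exponentiated, this is `exists_edgeProd_le`: the integrand decays exponentially in the logarithmic
distance to the profile `α*`. Integrating a product of two-sided exponentials gives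
`exists_motifProbOn_le`, a bound with a spare factor `t ^ a` on sets where `exp (-distance) ≤ t`. It
yields the upper bound on `P(H)` (`t = 1`), the negligibility of other profiles (`t` a negative
power of `n`), and the small mass outside the optimal window (`t = ε`). The lower bound comes from
the optimal window, where every factor has its nominal order. Expected counts are falling factorials
times these integrals. -/

noncomputable section

namespace HiddenVariable

/-! ### The objective as a piecewise linear function -/

/-- The sign of a class: `-1` on `S₁`, `1` on `S₂`, `0` on `S₃`. -/
def Part.sign : Part → ℝ
  | .S1 => -1
  | .S2 => 1
  | .S3 => 0

lemma Part.exponent_eq (s : Part) : s.exponent = 1 / 2 + s.sign / 2 := by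
  cases s <;> norm_num [Part.exponent, Part.sign]

instance : Finite Part :=
  Finite.of_injective (fun s : Part => SignType.sign s.sign) (by
    intro s t h
    cases s <;> cases t <;> first | rfl | (simp [Part.sign] at h))

open Classical in
/-- The edges of `H`, each listed once with its smaller end first. -/
def edgePairs {k : ℕ} (H : SimpleGraph (Fin k)) : Finset (Fin k × Fin k) :=
  Finset.univ.filter fun q : Fin k × Fin k => q.1 < q.2 ∧ H.Adj q.1 q.2

/-- The piecewise linear objective of the optimization over real profiles. -/
def logWeight (τ : ℝ) {k : ℕ} (H : SimpleGraph (Fin k)) (y : Fin k → ℝ) : ℝ :=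
  -(τ - 1) * ∑ i, y i + ∑ q ∈ edgePairs H, min (y q.1 + y q.2) 0

open Classical in
lemma sum_sign {k : ℕ} (P : VertexPartition k) :
    ∑ i, (P i).sign = (classSize P .S2 : ℝ) - classSize P .S1 := by
  unfold classSize
  rw [Finset.card_filter, Finset.card_filter]
  push_cast
  rw [← Finset.sum_sub_distrib]
  refine Finset.sum_congr rfl fun i _ => ?_
  cases P i <;> simp [Part.sign]

-- An edge inside `S₁` contributes `-2`, an edge between `S₁` and `S₃` contributes `-1`, and all
-- others contribute `0`; in particular the signs at the ends of an edge between `S₁` and `S₂`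
-- cancel.
open Classical in
lemma sum_edgePairs_sign {k : ℕ} (H : SimpleGraph (Fin k)) (P : VertexPartition k) :
    ∑ q ∈ edgePairs H, min ((P q.1).sign + (P q.2).sign) 0 =
      -(2 * (edgesInside H P .S1 : ℝ) + edgesBetween H P .S1 .S3) := by
  -- `edgesBetween` lists the `S₁`-end first, whereas `edgePairs` lists the smaller end first, so
  -- the count is split by the order of the ends.
  have hb : (edgesBetween H P .S1 .S3 : ℝ) =
      ∑ q : Fin k × Fin k, ((if q.1 < q.2 ∧ H.Adj q.1 q.2 ∧ P q.1 = .S1 ∧ P q.2 = .S3 then 1 else 0) +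
        (if q.1 < q.2 ∧ H.Adj q.1 q.2 ∧ P q.1 = .S3 ∧ P q.2 = .S1 then (1 : ℝ) else 0)) := by
    unfold edgesBetween
    rw [Finset.card_filter, Finset.sum_add_distrib, ← (Equiv.prodComm (Fin k) (Fin k)).sum_comp
      (fun q => if q.1 < q.2 ∧ H.Adj q.1 q.2 ∧ P q.1 = .S3 ∧ P q.2 = .S1 then (1 : ℝ) else 0),
      ← Finset.sum_add_distrib]
    push_cast
    refine Finset.sum_congr rfl fun q _ => ?_
    simp only [Equiv.prodComm_apply, Prod.fst_swap, Prod.snd_swap, H.adj_comm q.2 q.1]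
    rcases lt_trichotomy q.1 q.2 with h | h | h
    · simp [h, h.not_gt]
    · simp [h]
    · simp [h, h.not_gt, and_comm]
  rw [hb]
  unfold edgePairs edgesInside
  rw [Finset.card_filter, Finset.sum_filter]
  push_cast
  rw [Finset.mul_sum, ← Finset.sum_add_distrib, ← Finset.sum_neg_distrib]
  refine Finset.sum_congr rfl fun q _ => ?_
  by_cases h : q.1 < q.2 ∧ H.Adj q.1 q.2
  · obtain ⟨h1, h2⟩ := h
    cases P q.1 <;> cases P q.2 <;> simp [h1, h2, Part.sign]; norm_num
  · have h' : ∀ A : Prop, (q.1 < q.2 ∧ H.Adj q.1 q.2 ∧ A) = False := fun A => by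
      simp only [eq_iff_iff, iff_false]; tauto
    simp [h, h']

lemma logWeight_sign {τ : ℝ} (hτ : 2 < τ) {k : ℕ} (H : SimpleGraph (Fin k))
    (P : VertexPartition k) :
    logWeight τ H (fun i => (P i).sign) = (τ - 1) * objective τ H P := by
  have : τ - 1 ≠ 0 := by linarith
  rw [logWeight, sum_sign, sum_edgePairs_sign, objective]
  field_simp
  ring

/-! ### Layer-cake decomposition over thresholds -/

open Classical in
/-- The class of a vertex with coordinate `y` at the threshold `θ`. -/
def thresholdPart (y θ : ℝ) : Part :=
  if θ < y then .S2 else if θ < -y then .S1 else .S3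

lemma thresholdPart_sign (y : ℝ) {θ : ℝ} (hθ : 0 ≤ θ) : (thresholdPart y θ).sign =
    (if θ < y then 1 else 0) - (if θ < -y then 1 else 0) := by
  unfold thresholdPart
  split_ifs <;> simp [Part.sign]
  linarith

lemma intervalIntegrable_indicator_lt (a M : ℝ) :
    IntervalIntegrable (fun θ : ℝ => if θ < a then (1 : ℝ) else 0) volume 0 M := by
  have : AntitoneOn (fun θ : ℝ => if θ < a then (1 : ℝ) else 0) (Set.uIcc 0 M) := by
    intro x _ y _ h
    dsimp only
    split_ifs <;> linarith
  exact this.intervalIntegrable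

lemma integral_indicator_lt {a M : ℝ} (ha : 0 ≤ a) (haM : a ≤ M) :
    ∫ θ in (0 : ℝ)..M, (if θ < a then (1 : ℝ) else 0) = a := by
  have hab : ∀ b c : ℝ, IntervalIntegrable (fun θ : ℝ => if θ < a then (1 : ℝ) else 0) volume b c :=
    fun b c => (intervalIntegrable_indicator_lt a b).symm.trans (intervalIntegrable_indicator_lt a c)
  rw [← intervalIntegral.integral_add_adjacent_intervals (hab 0 a) (hab a M)]
  have h1 : ∫ θ in (0 : ℝ)..a, (if θ < a then (1 : ℝ) else 0) = ∫ θ in (0 : ℝ)..a, (1 : ℝ) := by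
    rw [intervalIntegral.integral_of_le ha, intervalIntegral.integral_of_le ha,
      integral_Ioc_eq_integral_Ioo, integral_Ioc_eq_integral_Ioo]
    exact setIntegral_congr_fun measurableSet_Ioo fun x hx => if_pos hx.2
  have h2 : ∫ θ in a..M, (if θ < a then (1 : ℝ) else 0) = ∫ θ in a..M, (0 : ℝ) :=
    intervalIntegral.integral_congr fun x hx => if_neg (by
      rw [Set.uIcc_of_le haM] at hx; exact not_lt.2 hx.1)
  rw [h1, h2]
  simp

/-- The layer-cake formula for a real number and its threshold signs. -/
lemma thresholdPart_integral {y M : ℝ} (hy : |y| ≤ M) :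
    IntervalIntegrable (fun θ => (thresholdPart y θ).sign) volume 0 M ∧
      ∫ θ in (0 : ℝ)..M, (thresholdPart y θ).sign = y := by
  have hM : 0 ≤ M := (abs_nonneg y).trans hy
  have hy' := abs_le.1 hy
  have hE : Set.EqOn (fun θ => (thresholdPart y θ).sign)
      (fun θ => (if θ < max y 0 then (1 : ℝ) else 0) - (if θ < max (-y) 0 then 1 else 0))
      (Set.uIcc 0 M) := by
    intro θ hθ
    rw [Set.uIcc_of_le hM] at hθ
    have := hθ.1
    simp only [thresholdPart_sign y hθ.1, lt_max_iff, not_lt.2 this, or_false]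
  have hI := (intervalIntegrable_indicator_lt (max y 0) M).sub
    (intervalIntegrable_indicator_lt (max (-y) 0) M)
  refine ⟨hI.congr_uIoo fun x hx => (hE (Set.Ioo_subset_Icc_self hx)).symm, ?_⟩
  rw [intervalIntegral.integral_congr hE, intervalIntegral.integral_sub
    (intervalIntegrable_indicator_lt _ M) (intervalIntegrable_indicator_lt _ M),
    integral_indicator_lt (le_max_right _ _) (max_le hy'.2 hM),
    integral_indicator_lt (le_max_right _ _) (max_le (by linarith) hM)]
  rcases le_total y 0 with h | h
  · rw [max_eq_right h, max_eq_left (by linarith)]; ring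
  · rw [max_eq_left h, max_eq_right (by linarith)]; ring

/-- The layer-cake formula for the weight of an edge. -/
lemma thresholdPart_integral_min {y z M : ℝ} (hy : |y| ≤ M) (hz : |z| ≤ M) :
    IntervalIntegrable (fun θ => min ((thresholdPart y θ).sign + (thresholdPart z θ).sign) 0)
      volume 0 M ∧
      ∫ θ in (0 : ℝ)..M, min ((thresholdPart y θ).sign + (thresholdPart z θ).sign) 0
        = min (y + z) 0 := by
  have hM : 0 ≤ M := (abs_nonneg y).trans hy
  wlog hyz : z ≤ y generalizing y z
  · simpa only [add_comm] using this hz hy (by linarith)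
  have hy' := abs_le.1 hy
  have hz' := abs_le.1 hz
  -- With `z ≤ y`: once `z` is in `S₁` the edge costs `1`, unless `y` is in `S₂`, which refunds it;
  -- if `y` is in `S₁` too, the cost is one more. If `z` is not in `S₁`, neither is `y`, and the
  -- edge is free.
  have hE : Set.EqOn (fun θ => min ((thresholdPart y θ).sign + (thresholdPart z θ).sign) 0)
      (fun θ => ((if θ < max (min y (-z)) 0 then (1 : ℝ) else 0) -
        (if θ < max (-z) 0 then 1 else 0)) - (if θ < max (-y) 0 then 1 else 0))
      (Set.uIcc 0 M) := by
    intro θ hθ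
    rw [Set.uIcc_of_le hM] at hθ
    have h0 := hθ.1
    simp only [thresholdPart_sign _ hθ.1, lt_max_iff, not_lt.2 h0, or_false, lt_min_iff]
    split_ifs <;> first | (norm_num; done) | (exfalso; grind)
  have hi := fun a => intervalIntegrable_indicator_lt a M
  refine ⟨(((hi _).sub (hi _)).sub (hi _)).congr_uIoo fun x hx =>
    (hE (Set.Ioo_subset_Icc_self hx)).symm, ?_⟩
  rw [intervalIntegral.integral_congr hE, intervalIntegral.integral_sub ((hi _).sub (hi _)) (hi _),
    intervalIntegral.integral_sub (hi _) (hi _),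
    integral_indicator_lt (le_max_right _ _) (max_le ((min_le_left _ _).trans hy'.2) hM),
    integral_indicator_lt (le_max_right _ _) (max_le (by linarith) hM),
    integral_indicator_lt (le_max_right _ _) (max_le (by linarith) hM)]
  grind

/-- The layer-cake formula for the objective. -/
lemma logWeight_integral (τ : ℝ) {k : ℕ} (H : SimpleGraph (Fin k)) {y : Fin k → ℝ} {M : ℝ}
    (hy : ∀ i, |y i| ≤ M) :
    IntervalIntegrable (fun θ => logWeight τ H fun i => (thresholdPart (y i) θ).sign) volume 0 M ∧
      ∫ θ in (0 : ℝ)..M, logWeight τ H (fun i => (thresholdPart (y i) θ).sign)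
        = logWeight τ H y := by
  have h1 : IntervalIntegrable (fun θ => ∑ i, (thresholdPart (y i) θ).sign) volume 0 M := by
    simpa only [Finset.sum_fn] using IntervalIntegrable.sum Finset.univ
      fun i _ => (thresholdPart_integral (hy i)).1
  have h2 : IntervalIntegrable (fun θ => ∑ q ∈ edgePairs H,
      min ((thresholdPart (y q.1) θ).sign + (thresholdPart (y q.2) θ).sign) 0) volume 0 M := by
    simpa only [Finset.sum_fn] using IntervalIntegrable.sum (edgePairs H)
      fun q _ => (thresholdPart_integral_min (hy q.1) (hy q.2)).1
  refine ⟨(h1.const_mul _).add h2, ?_⟩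
  unfold logWeight
  rw [intervalIntegral.integral_add (h1.const_mul _) h2, intervalIntegral.integral_const_mul,
    intervalIntegral.integral_finsetSum fun i _ => (thresholdPart_integral (hy i)).1,
    intervalIntegral.integral_finsetSum
      fun q _ => (thresholdPart_integral_min (hy q.1) (hy q.2)).1]
  congr 1
  · congr 1
    exact Finset.sum_congr rfl fun i _ => (thresholdPart_integral (hy i)).2
  · exact Finset.sum_congr rfl fun q _ => (thresholdPart_integral_min (hy q.1) (hy q.2)).2

/-! ### Sharpness of the maximum -/

/-- A unique optimal partition beats every other one by a fixed amount. -/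
lemma exists_objective_gap {τ : ℝ} {k : ℕ} {H : SimpleGraph (Fin k)} {P : VertexPartition k}
    (hopt : IsOptimal τ H P) (huniq : ∀ Q, IsOptimal τ H Q → Q = P) :
    ∃ δ : ℝ, 0 < δ ∧ ∀ Q : VertexPartition k, Q ≠ P → objective τ H Q ≤ objective τ H P - δ := by
  have hlt : ∀ Q : VertexPartition k, Q ≠ P → 0 < objective τ H P - objective τ H Q := by
    intro Q hQ
    by_contra h
    exact hQ (huniq Q fun R => (hopt R).trans (by linarith))
  rcases isEmpty_or_nonempty {Q : VertexPartition k // Q ≠ P} with h | h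
  · exact ⟨1, one_pos, fun Q hQ => (h.false ⟨Q, hQ⟩).elim⟩
  · obtain ⟨Q₀, hQ₀⟩ := Finite.exists_min
      fun Q : {Q : VertexPartition k // Q ≠ P} => objective τ H P - objective τ H Q
    exact ⟨_, hlt Q₀ Q₀.2, fun Q hQ => by linarith [hQ₀ ⟨Q, hQ⟩]⟩

lemma abs_sign_sub_sign_le (s t : Part) : |s.sign - t.sign| ≤ 2 := by
  cases s <;> cases t <;> norm_num [Part.sign, abs_le]

/-- At every threshold, the loss of the threshold partition against the optimal one is at least
linear in the distance of the signs. -/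
lemma exists_logWeight_threshold_le {τ : ℝ} (hτ : 2 < τ) {k : ℕ} {H : SimpleGraph (Fin k)}
    {P : VertexPartition k} (hopt : IsOptimal τ H P) (huniq : ∀ Q, IsOptimal τ H Q → Q = P) :
    ∃ c : ℝ, 0 < c ∧ ∀ (L : ℝ) (y : Fin k → ℝ), (∀ i, -L ≤ y i) → ∀ θ : ℝ, 0 ≤ θ →
      logWeight τ H (fun i => (thresholdPart (y i) θ).sign) ≤
        (if θ < L then 1 else 0) * ((τ - 1) * objective τ H P) -
          c * ∑ i, |(thresholdPart (y i) θ).sign - (if θ < L then 1 else 0) * (P i).sign| := by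
  obtain ⟨δ, hδ, hgap⟩ := exists_objective_gap hopt huniq
  have hτ1 : 0 < τ - 1 := by linarith
  -- The first bound spreads the gap `δ` over a sign distance of at most `2 k`, with `k + 1` keeping
  -- the denominator positive when `k = 0`; the second serves the thresholds `θ ≥ L`.
  refine ⟨min ((τ - 1) * δ / (2 * (k + 1))) (τ - 1), by positivity, fun L y hy θ hθ => ?_⟩
  set c := min ((τ - 1) * δ / (2 * (k + 1))) (τ - 1)
  by_cases hL : θ < L
  · simp only [if_pos hL, one_mul]
    rw [logWeight_sign hτ]
    by_cases hQ : (fun i => thresholdPart (y i) θ) = P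
    · have : ∀ i, thresholdPart (y i) θ = P i := fun i => congrFun hQ i
      simp [this]
    · have h1 := mul_le_mul_of_nonneg_left (hgap _ hQ) hτ1.le
      have h2 : ∑ i, |(thresholdPart (y i) θ).sign - (P i).sign| ≤ 2 * (k + 1) := by
        refine (Finset.sum_le_sum fun i _ => abs_sign_sub_sign_le _ _).trans ?_
        simp
        linarith
      have h3 : c * ∑ i, |(thresholdPart (y i) θ).sign - (P i).sign| ≤ (τ - 1) * δ := by
        refine (mul_le_mul (min_le_left _ _) h2 (Finset.sum_nonneg fun i _ => abs_nonneg _)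
          (by positivity)).trans_eq ?_
        field_simp
      linarith
  · simp only [if_neg hL, zero_mul, sub_zero, zero_sub]
    -- Since `-y i ≤ L ≤ θ`, no vertex is in `S₁`: all edges are free, and only the vertex cost of
    -- `S₂` remains.
    have hs : ∀ i, 0 ≤ (thresholdPart (y i) θ).sign := by
      intro i
      have : ¬ θ < -y i := by linarith [hy i]
      rw [thresholdPart_sign _ hθ, if_neg this]
      split_ifs <;> norm_num
    have h1 : ∑ q ∈ edgePairs H,
        min ((thresholdPart (y q.1) θ).sign + (thresholdPart (y q.2) θ).sign) 0 = 0 :=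
      Finset.sum_eq_zero fun q _ => min_eq_right (add_nonneg (hs _) (hs _))
    simp only [logWeight, h1, abs_of_nonneg (hs _), add_zero, neg_mul]
    exact neg_le_neg (mul_le_mul_of_nonneg_right (min_le_right _ _)
      (Finset.sum_nonneg fun i _ => hs i))

/-- The unique optimal partition gives a sharp maximum of the piecewise linear objective. -/
theorem exists_logWeight_le {τ : ℝ} (hτ : 2 < τ) {k : ℕ} {H : SimpleGraph (Fin k)}
    {P : VertexPartition k} (hopt : IsOptimal τ H P) (huniq : ∀ Q, IsOptimal τ H Q → Q = P) :
    ∃ c : ℝ, 0 < c ∧ ∀ L : ℝ, 0 ≤ L → ∀ y : Fin k → ℝ, (∀ i, -L ≤ y i) →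
      logWeight τ H y ≤ L * ((τ - 1) * objective τ H P) - c * ∑ i, |y i - L * (P i).sign| := by
  obtain ⟨c, hc, hθ⟩ := exists_logWeight_threshold_le hτ hopt huniq
  refine ⟨c, hc, fun L hL y hy => ?_⟩
  -- Any `M` beyond `L` and all `|y i|` will do: from there on all vertices are in `S₃` and the
  -- integrands vanish.
  obtain ⟨M, hM⟩ : ∃ M, L ≤ M ∧ ∀ i, |y i| ≤ M :=
    ⟨L + ∑ i, |y i|, le_add_of_nonneg_right (Finset.sum_nonneg fun i _ => abs_nonneg _), fun i =>
      (Finset.single_le_sum (fun j _ => abs_nonneg (y j)) (Finset.mem_univ i)).trans (by linarith)⟩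
  have hM0 : 0 ≤ M := hL.trans hM.1
  have hI := intervalIntegrable_indicator_lt L M
  have hsub : ∀ i, IntervalIntegrable (fun θ : ℝ => (thresholdPart (y i) θ).sign -
      (if θ < L then 1 else 0) * (P i).sign) volume 0 M := fun i =>
    (thresholdPart_integral (hM.2 i)).1.sub (hI.mul_const _)
  have habs : IntervalIntegrable (fun θ : ℝ => ∑ i, |(thresholdPart (y i) θ).sign -
      (if θ < L then 1 else 0) * (P i).sign|) volume 0 M := by
    simpa only [Finset.sum_fn] using IntervalIntegrable.sum Finset.univ fun i _ => (hsub i).abs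
  have hdist : ∀ i, |y i - L * (P i).sign| ≤ ∫ θ in (0 : ℝ)..M,
      |(thresholdPart (y i) θ).sign - (if θ < L then 1 else 0) * (P i).sign| := by
    intro i
    have : y i - L * (P i).sign = ∫ θ in (0 : ℝ)..M,
        ((thresholdPart (y i) θ).sign - (if θ < L then 1 else 0) * (P i).sign) := by
      rw [intervalIntegral.integral_sub (thresholdPart_integral (hM.2 i)).1 (hI.mul_const _),
        (thresholdPart_integral (hM.2 i)).2, intervalIntegral.integral_mul_const,
        integral_indicator_lt hL hM.1]
    rw [this]
    exact intervalIntegral.abs_integral_le_integral_abs hM0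
  rw [← (logWeight_integral τ H hM.2).2]
  refine (intervalIntegral.integral_mono_on hM0 (logWeight_integral τ H hM.2).1
    ((hI.mul_const _).sub (habs.const_mul c)) fun θ h => hθ L y hy θ h.1).trans ?_
  rw [intervalIntegral.integral_sub (hI.mul_const _) (habs.const_mul c),
    intervalIntegral.integral_mul_const, intervalIntegral.integral_const_mul,
    integral_indicator_lt hL hM.1, intervalIntegral.integral_finsetSum fun i _ => (hsub i).abs]
  gcongr with i
  exact hdist i

/-! ### Expected counts as integrals -/

/-- Restricting i.i.d. coordinates along an injection gives i.i.d. coordinates. -/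
lemma map_comp_pi {ι κ α : Type*} [Fintype ι] [Fintype κ] [MeasurableSpace α] (ν : Measure α)
    [IsProbabilityMeasure ν] {g : ι → κ} (hg : g.Injective) :
    (Measure.pi fun _ : κ => ν).map (fun h => h ∘ g) = Measure.pi fun _ : ι => ν := by
  have h1 : ProbabilityTheory.iIndepFun (fun (i : κ) (h : κ → α) => h i)
      (Measure.pi fun _ : κ => ν) :=
    ProbabilityTheory.iIndepFun_pi (X := fun _ x => x) fun _ => aemeasurable_id
  have h2 := (ProbabilityTheory.iIndepFun_iff_map_fun_eq_pi_map
    (fun i => (measurable_pi_apply (g i)).aemeasurable)).1 (h1.precomp hg)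
  refine h2.trans ?_
  congr 1
  funext i
  exact (measurePreserving_eval (fun _ : κ => ν) (g i)).map_eq

/-- The product of the connection probabilities over the edges of the motif. -/
def edgeProd (τ hmin : ℝ) {k : ℕ} (H : SimpleGraph (Fin k)) (n : ℕ) (h : Fin k → ℝ) : ℝ :=
  ∏ q ∈ edgePairs H, connProb τ hmin n (h q.1) (h q.2)

lemma measurable_connProb (τ hmin : ℝ) (n : ℕ) :
    Measurable fun x : ℝ × ℝ => connProb τ hmin n x.1 x.2 := by
  unfold connProb
  fun_prop

lemma measurable_edgeProd (τ hmin : ℝ) {k : ℕ} (H : SimpleGraph (Fin k)) (n : ℕ) :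
    Measurable (edgeProd τ hmin H n) := by
  unfold edgeProd connProb
  fun_prop

lemma connProb_le_one (τ hmin : ℝ) (n : ℕ) (x y : ℝ) : connProb τ hmin n x y ≤ 1 :=
  min_le_right _ _

lemma isProbabilityMeasure_hiddenLaw {τ hmin : ℝ} (hτ : 2 < τ) (hmin_pos : 0 < hmin) :
    IsProbabilityMeasure (hiddenLaw τ hmin) :=
  ProbabilityTheory.isProbabilityMeasure_paretoMeasure hmin_pos (by linarith)

/-- The law lives on all of `ℝ`, and `connProb` may be negative there. The bounds `0 ≤ connProb` and
`0 ≤ edgeProd ≤ 1` are therefore used only almost everywhere, above `hmin`. -/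
lemma hiddenLaw_ae_le (τ hmin : ℝ) : ∀ᵐ x ∂(hiddenLaw τ hmin), hmin ≤ x := by
  rw [ae_iff]
  have : {x : ℝ | ¬ hmin ≤ x} = Set.Iio hmin := by ext; simp
  rw [this, hiddenLaw, ProbabilityTheory.paretoMeasure, withDensity_apply _ measurableSet_Iio]
  exact ProbabilityTheory.lintegral_paretoPDF_of_le le_rfl

lemma pi_hiddenLaw_ae_le {τ hmin : ℝ} (hτ : 2 < τ) (hmin_pos : 0 < hmin) (ι : Type*) [Fintype ι] :
    ∀ᵐ h ∂(Measure.pi fun _ : ι => hiddenLaw τ hmin), ∀ i, hmin ≤ h i := by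
  have := isProbabilityMeasure_hiddenLaw hτ hmin_pos
  rw [ae_all_iff]
  exact fun i => (measurePreserving_eval (fun _ : ι => hiddenLaw τ hmin) i).quasiMeasurePreserving.ae
    (hiddenLaw_ae_le τ hmin)

/-- Integrals against the law of a hidden variable, through its density. -/
lemma setIntegral_hiddenLaw {τ hmin : ℝ} (hτ : 2 < τ) (hmin_pos : 0 < hmin) {s : Set ℝ}
    (hs : MeasurableSet s) (g : ℝ → ℝ) :
    ∫ x in s, g x ∂(hiddenLaw τ hmin) =
      ∫ x in s, ProbabilityTheory.paretoPDFReal hmin (τ - 1) x * g x := by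
  rw [hiddenLaw, ProbabilityTheory.paretoMeasure, restrict_withDensity hs]
  unfold ProbabilityTheory.paretoPDF
  rw [integral_withDensity_eq_integral_toReal_smul (by fun_prop) (by simp)]
  refine integral_congr_ae (Eventually.of_forall fun x => ?_)
  simp only [smul_eq_mul]
  rw [ENNReal.toReal_ofReal
    (ProbabilityTheory.paretoPDFReal_nonneg hmin_pos.le (by linarith) x)]

lemma integral_hiddenLaw {τ hmin : ℝ} (hτ : 2 < τ) (hmin_pos : 0 < hmin) (g : ℝ → ℝ) :
    ∫ x, g x ∂(hiddenLaw τ hmin) =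
      (τ - 1) * hmin ^ (τ - 1) * ∫ x in Set.Ioi hmin, x ^ (-τ) * g x := by
  rw [← setIntegral_univ, setIntegral_hiddenLaw hτ hmin_pos MeasurableSet.univ, setIntegral_univ,
    ← integral_Ici_eq_integral_Ioi, ← integral_const_mul, ← integral_indicator measurableSet_Ici]
  refine integral_congr_ae (Eventually.of_forall fun x => ?_)
  simp only [ProbabilityTheory.paretoPDFReal, Set.indicator, Set.mem_Ici]
  split_ifs <;> ring_nf

lemma meanHidden_pos {τ hmin : ℝ} (hτ : 2 < τ) (hmin_pos : 0 < hmin) : 0 < meanHidden τ hmin := by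
  have h : ∫ x in Set.Ioi hmin, x ^ (-τ) * x = ∫ x in Set.Ioi hmin, x ^ (1 - τ) := by
    refine setIntegral_congr_fun measurableSet_Ioi fun x hx => ?_
    have hx0 : 0 < x := hmin_pos.trans hx
    rw [sub_eq_neg_add, Real.rpow_add hx0, Real.rpow_one]
  rw [meanHidden, integral_hiddenLaw hτ hmin_pos, h, integral_Ioi_rpow_of_lt (by linarith) hmin_pos]
  have h1 : 0 < τ - 1 := by linarith
  have h2 : -hmin ^ (1 - τ + 1) / (1 - τ + 1) = hmin ^ (1 - τ + 1) / (τ - 2) := by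
    rw [show 1 - τ + 1 = -(τ - 2) by ring, neg_div_neg_eq]
  have h3 : 0 < τ - 2 := by linarith
  rw [h2]
  positivity

lemma connProb_nonneg {τ hmin : ℝ} (hτ : 2 < τ) (hmin_pos : 0 < hmin) (n : ℕ) {x y : ℝ}
    (hx : hmin ≤ x) (hy : hmin ≤ y) : 0 ≤ connProb τ hmin n x y := by
  have := meanHidden_pos hτ hmin_pos
  have hx := hmin_pos.trans_le hx
  have hy := hmin_pos.trans_le hy
  unfold connProb
  positivity

lemma edgeProd_nonneg {τ hmin : ℝ} (hτ : 2 < τ) (hmin_pos : 0 < hmin) {k : ℕ}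
    (H : SimpleGraph (Fin k)) (n : ℕ) {h : Fin k → ℝ} (hh : ∀ i, hmin ≤ h i) :
    0 ≤ edgeProd τ hmin H n h :=
  Finset.prod_nonneg fun _ _ => connProb_nonneg hτ hmin_pos n (hh _) (hh _)

lemma edgeProd_le_one {τ hmin : ℝ} (hτ : 2 < τ) (hmin_pos : 0 < hmin) {k : ℕ}
    (H : SimpleGraph (Fin k)) (n : ℕ) {h : Fin k → ℝ} (hh : ∀ i, hmin ≤ h i) :
    edgeProd τ hmin H n h ≤ 1 :=
  Finset.prod_le_one (fun _ _ => connProb_nonneg hτ hmin_pos n (hh _) (hh _))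
    fun _ _ => connProb_le_one _ _ _ _ _

lemma integrable_edgeProd {τ hmin : ℝ} (hτ : 2 < τ) (hmin_pos : 0 < hmin) {k : ℕ}
    (H : SimpleGraph (Fin k)) (n : ℕ) :
    Integrable (edgeProd τ hmin H n) (Measure.pi fun _ : Fin k => hiddenLaw τ hmin) := by
  have := isProbabilityMeasure_hiddenLaw hτ hmin_pos
  refine Integrable.of_bound (measurable_edgeProd τ hmin H n).aestronglyMeasurable 1 ?_
  filter_upwards [pi_hiddenLaw_ae_le hτ hmin_pos (Fin k)] with h hh
  rw [Real.norm_of_nonneg (edgeProd_nonneg hτ hmin_pos H n hh)]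
  exact edgeProd_le_one hτ hmin_pos H n hh

/-- The edges of the motif are mapped to distinct pairs of vertices. -/
lemma injective_sym2_edgePairs {k n : ℕ} (H : SimpleGraph (Fin k)) (f : Fin k ↪ Fin n) :
    Function.Injective fun q : edgePairs H => s(f q.1.1, f q.1.2) := by
  rintro ⟨⟨a, b⟩, hq⟩ ⟨⟨c, d⟩, hr⟩ h
  simp only [edgePairs, Finset.mem_filter, Finset.mem_univ, true_and] at hq hr
  simp only [Sym2.eq_iff, f.injective.eq_iff] at h
  rcases h with ⟨rfl, rfl⟩ | ⟨rfl, rfl⟩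
  · rfl
  · exact (lt_asymm hq.1 hr.1).elim

/-- The outcomes for which a given placement `f` of the motif is a copy. -/
def edgeEvent (τ hmin : ℝ) {k : ℕ} (H : SimpleGraph (Fin k)) {n : ℕ} (f : Fin k ↪ Fin n) :
    Set (Sample n) :=
  {ω | ∀ q ∈ edgePairs H,
    (ω.2 s(f q.1, f q.2) : ℝ) ≤ connProb τ hmin n (ω.1 (f q.1)) (ω.1 (f q.2))}

lemma measurableSet_edgeEvent (τ hmin : ℝ) {k : ℕ} (H : SimpleGraph (Fin k)) {n : ℕ}
    (f : Fin k ↪ Fin n) : MeasurableSet (edgeEvent τ hmin H f) := by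
  have : edgeEvent τ hmin H f = ⋂ q ∈ edgePairs H, {ω : Sample n |
      (ω.2 s(f q.1, f q.2) : ℝ) ≤ connProb τ hmin n (ω.1 (f q.1)) (ω.1 (f q.2))} := by
    ext ω; simp [edgeEvent]
  rw [this]
  refine Finset.measurableSet_biInter _ fun q _ => measurableSet_le (by fun_prop) ?_
  exact (measurable_connProb τ hmin n).comp
    (g := fun x : ℝ × ℝ => connProb τ hmin n x.1 x.2) (f := fun ω : Sample n =>
      (ω.1 (f q.1), ω.1 (f q.2))) (by fun_prop)

lemma volume_coe_le {p : ℝ} (h0 : 0 ≤ p) (h1 : p ≤ 1) :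
    (volume {u : unitInterval | (u : ℝ) ≤ p}) = ENNReal.ofReal p :=
  unitInterval.volume_Iic (x := ⟨p, h0, h1⟩)

/-- Conditionally on the hidden variables, a placement is a copy with probability `edgeProd`. -/
lemma measure_edgeEvent_section {τ hmin : ℝ} (hτ : 2 < τ) (hmin_pos : 0 < hmin) {k : ℕ}
    (H : SimpleGraph (Fin k)) {n : ℕ} (f : Fin k ↪ Fin n) {h : Fin n → ℝ}
    (hh : ∀ i, hmin ≤ h i) :
    (Measure.pi fun _ : Sym2 (Fin n) => (volume : Measure unitInterval)).real
      {u | (h, u) ∈ edgeEvent τ hmin H f} = edgeProd τ hmin H n (h ∘ f) := by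
  have hset : {u : Sym2 (Fin n) → unitInterval | (h, u) ∈ edgeEvent τ hmin H f} =
      (fun u => u ∘ fun q : edgePairs H => s(f q.1.1, f q.1.2)) ⁻¹'
        Set.univ.pi fun q : edgePairs H => {u : unitInterval |
          (u : ℝ) ≤ connProb τ hmin n (h (f q.1.1)) (h (f q.1.2))} := by
    ext u
    simp [edgeEvent]
  have hms : MeasurableSet (Set.univ.pi fun q : edgePairs H => {u : unitInterval |
      (u : ℝ) ≤ connProb τ hmin n (h (f q.1.1)) (h (f q.1.2))}) :=
    MeasurableSet.univ_pi fun q => measurableSet_le measurable_subtype_coe measurable_const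
  -- Distinct edges read distinct coordinates, so the relevant numbers are again i.i.d. uniform and
  -- the probability factors.
  rw [hset, measureReal_def, ← Measure.map_apply (by fun_prop) hms,
    map_comp_pi volume (injective_sym2_edgePairs H f), Measure.pi_pi, ENNReal.toReal_prod,
    edgeProd, ← Finset.prod_coe_sort (edgePairs H)]
  refine Finset.prod_congr rfl fun q _ => ?_
  have h0 := connProb_nonneg hτ hmin_pos n (hh (f q.1.1)) (hh (f q.1.2))
  rw [volume_coe_le h0 (connProb_le_one _ _ _ _ _), ENNReal.toReal_ofReal h0]
  rfl

/-- The probability that a placement is a copy with hidden variables in `B`. -/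
lemma measure_edgeEvent_inter {τ hmin : ℝ} (hτ : 2 < τ) (hmin_pos : 0 < hmin) {k : ℕ}
    (H : SimpleGraph (Fin k)) {n : ℕ} (f : Fin k ↪ Fin n) {B : Set (Fin k → ℝ)}
    (hB : MeasurableSet B) :
    (modelMeasure τ hmin n).real (edgeEvent τ hmin H f ∩ {ω | ω.1 ∘ f ∈ B}) =
      ∫ h in B, edgeProd τ hmin H n h ∂(Measure.pi fun _ : Fin k => hiddenLaw τ hmin) := by
  have := isProbabilityMeasure_hiddenLaw hτ hmin_pos
  have hmB : MeasurableSet {ω : Sample n | ω.1 ∘ f ∈ B} :=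
    (show Measurable fun ω : Sample n => ω.1 ∘ f by fun_prop) hB
  have hm := (measurableSet_edgeEvent τ hmin H f).inter hmB
  have hc : Measurable fun h : Fin n → ℝ => h ∘ f := by fun_prop
  -- The integral over `k` variables is pulled back along `f` to all `n` variables, and Fubini
  -- integrates out the pair numbers first.
  rw [← map_comp_pi (hiddenLaw τ hmin) f.injective, ← integral_indicator hB,
    integral_map hc.aemeasurable ((measurable_edgeProd τ hmin H n).indicator hB).aestronglyMeasurable,
    ← integral_indicator_one hm, modelMeasure,
    integral_prod _ (show Integrable (Set.indicator _ (1 : Sample n → ℝ)) _ from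
      (integrable_const (1 : ℝ)).indicator hm)]
  refine integral_congr_ae ?_
  filter_upwards [pi_hiddenLaw_ae_le hτ hmin_pos (Fin n)] with h hh
  by_cases hb : h ∘ f ∈ B
  · rw [Set.indicator_of_mem hb, ← measure_edgeEvent_section hτ hmin_pos H f hh,
      ← integral_indicator_one (show MeasurableSet {u | (h, u) ∈ edgeEvent τ hmin H f} from
        measurable_prodMk_left (measurableSet_edgeEvent τ hmin H f))]
    refine integral_congr_ae (Eventually.of_forall fun u => ?_)
    have hiff : (h, u) ∈ edgeEvent τ hmin H f ∩ {ω : Sample n | ω.1 ∘ f ∈ B} ↔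
        u ∈ {u | (h, u) ∈ edgeEvent τ hmin H f} := ⟨fun hu => hu.1, fun hu => ⟨hu, hb⟩⟩
    by_cases hu : u ∈ {u | (h, u) ∈ edgeEvent τ hmin H f}
    · rw [Set.indicator_of_mem hu]; exact Set.indicator_of_mem (hiff.2 hu) _
    · rw [Set.indicator_of_notMem hu]; exact Set.indicator_of_notMem (mt hiff.1 hu) _
  · rw [Set.indicator_of_notMem hb]
    simp [hb]

/-- The copies of `H` with hidden variables in `B` are the placements that are copies. -/
lemma card_copy_eq_sum (τ hmin : ℝ) {k : ℕ} (H : SimpleGraph (Fin k)) (n : ℕ)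
    (B : Set (Fin k → ℝ)) (ω : Sample n) :
    (Nat.card {f : H.Copy (modelGraph τ hmin n ω) // ω.1 ∘ f ∈ B} : ℝ) =
      ∑ f : Fin k ↪ Fin n, (edgeEvent τ hmin H f ∩ {ω | ω.1 ∘ f ∈ B}).indicator 1 ω := by
  classical
  have hadj : ∀ f : Fin k ↪ Fin n, ω ∈ edgeEvent τ hmin H f →
      ∀ {a b : Fin k}, H.Adj a b → (modelGraph τ hmin n ω).Adj (f a) (f b) := by
    intro f hf a b hab
    wlog hlt : a < b generalizing a b
    · exact (this hab.symm (lt_of_le_of_ne (not_lt.1 hlt) hab.ne.symm)).symm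
    exact ⟨f.injective.ne hab.ne, hf (a, b) (by simp [edgePairs, hlt, hab])⟩
  let e : {f : H.Copy (modelGraph τ hmin n ω) // ω.1 ∘ f ∈ B} ≃
      {f : Fin k ↪ Fin n // ω ∈ edgeEvent τ hmin H f ∩ {ω | ω.1 ∘ f ∈ B}} :=
    { toFun := fun f => ⟨f.1.toEmbedding, fun q hq => by
          have : H.Adj q.1 q.2 := (Finset.mem_filter.1 hq).2.2
          exact (f.1.toHom.map_adj this).2, f.2⟩
      invFun := fun f => ⟨⟨⟨f.1, fun hab => hadj f.1 f.2.1 hab⟩, f.1.injective⟩, f.2.2⟩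
      left_inv := fun f => rfl
      right_inv := fun f => rfl }
  rw [Nat.card_congr e, Nat.card_eq_fintype_card, Fintype.card_subtype, Finset.card_filter]
  push_cast
  exact Finset.sum_congr rfl fun f _ => by simp [Set.indicator]

lemma integral_card_copy {τ hmin : ℝ} (hτ : 2 < τ) (hmin_pos : 0 < hmin) {k : ℕ}
    (H : SimpleGraph (Fin k)) (n : ℕ) {B : Set (Fin k → ℝ)} (hB : MeasurableSet B) :
    ∫ ω, (Nat.card {f : H.Copy (modelGraph τ hmin n ω) // ω.1 ∘ f ∈ B} : ℝ)
        ∂(modelMeasure τ hmin n) =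
      n.descFactorial k *
        ∫ h in B, edgeProd τ hmin H n h ∂(Measure.pi fun _ : Fin k => hiddenLaw τ hmin) := by
  have := isProbabilityMeasure_hiddenLaw hτ hmin_pos
  have : IsProbabilityMeasure (modelMeasure τ hmin n) := by unfold modelMeasure; infer_instance
  have hm : ∀ f : Fin k ↪ Fin n,
      MeasurableSet (edgeEvent τ hmin H f ∩ {ω | ω.1 ∘ f ∈ B}) := fun f =>
    (measurableSet_edgeEvent τ hmin H f).inter
      ((show Measurable fun ω : Sample n => ω.1 ∘ f by fun_prop) hB)
  simp_rw [card_copy_eq_sum]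
  rw [integral_finsetSum _ fun f _ => show Integrable (Set.indicator _ (1 : Sample n → ℝ)) _ from
    (integrable_const (1 : ℝ)).indicator (hm f)]
  simp_rw [integral_indicator_one (hm _), measure_edgeEvent_inter hτ hmin_pos H _ hB]
  simp [Fintype.card_embedding_eq]

/-- The hidden variables allowed by the window of a profile. -/
def window {k : ℕ} (α : Fin k → ℝ) (ε : ℝ) (n : ℕ) : Set (Fin k → ℝ) :=
  Set.univ.pi fun i => Set.Icc (ε * (n : ℝ) ^ α i) (1 / ε * (n : ℝ) ^ α i)

lemma measurableSet_window {k : ℕ} (α : Fin k → ℝ) (ε : ℝ) (n : ℕ) :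
    MeasurableSet (window α ε n) :=
  MeasurableSet.univ_pi fun _ => measurableSet_Icc

/-- The probability that `k` given vertices form a copy of `H` with hidden variables in `B`. -/
def motifProbOn (τ hmin : ℝ) {k : ℕ} (H : SimpleGraph (Fin k)) (n : ℕ) (B : Set (Fin k → ℝ)) : ℝ :=
  ∫ h in B, edgeProd τ hmin H n h ∂(Measure.pi fun _ : Fin k => hiddenLaw τ hmin)

lemma motifProb_eq (τ hmin : ℝ) {k : ℕ} (H : SimpleGraph (Fin k)) (n : ℕ) :
    motifProb τ hmin H n = motifProbOn τ hmin H n Set.univ := by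
  rw [motifProbOn, setIntegral_univ]; rfl

theorem expCount_eq {τ hmin : ℝ} (hτ : 2 < τ) (hmin_pos : 0 < hmin) {k : ℕ}
    (H : SimpleGraph (Fin k)) (n : ℕ) :
    expCount τ hmin H n = n.descFactorial k * motifProbOn τ hmin H n Set.univ := by
  classical
  rw [motifProbOn, ← integral_card_copy hτ hmin_pos H n MeasurableSet.univ, expCount]
  refine integral_congr_ae (Eventually.of_forall fun ω => ?_)
  simp only [SimpleGraph.labelledCopyCount, Set.mem_univ]
  rw [Nat.card_congr (Equiv.subtypeUnivEquiv fun _ => trivial), Nat.card_eq_fintype_card]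
  congr!

theorem expWindowCount_eq {τ hmin : ℝ} (hτ : 2 < τ) (hmin_pos : 0 < hmin) {k : ℕ}
    (H : SimpleGraph (Fin k)) (α : Fin k → ℝ) (ε : ℝ) (n : ℕ) :
    expWindowCount τ hmin H α ε n = n.descFactorial k * motifProbOn τ hmin H n (window α ε n) := by
  rw [motifProbOn, ← integral_card_copy hτ hmin_pos H n (measurableSet_window α ε n),
    expWindowCount]
  refine integral_congr_ae (Eventually.of_forall fun ω => ?_)
  simp only [windowCount, window, Set.mem_univ_pi, Function.comp_apply]

lemma motifProbOn_mono {τ hmin : ℝ} (hτ : 2 < τ) (hmin_pos : 0 < hmin) {k : ℕ}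
    (H : SimpleGraph (Fin k)) (n : ℕ) {A B : Set (Fin k → ℝ)} (hAB : A ⊆ B) :
    motifProbOn τ hmin H n A ≤ motifProbOn τ hmin H n B := by
  refine setIntegral_mono_set (integrable_edgeProd hτ hmin_pos H n).integrableOn ?_
    hAB.eventuallyLE
  filter_upwards [ae_restrict_of_ae (pi_hiddenLaw_ae_le hτ hmin_pos (Fin k))] with h hh
  exact edgeProd_nonneg hτ hmin_pos H n hh

lemma motifProbOn_compl {τ hmin : ℝ} (hτ : 2 < τ) (hmin_pos : 0 < hmin) {k : ℕ}
    (H : SimpleGraph (Fin k)) (n : ℕ) {A : Set (Fin k → ℝ)} (hA : MeasurableSet A) :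
    motifProbOn τ hmin H n A + motifProbOn τ hmin H n Aᶜ = motifProbOn τ hmin H n Set.univ := by
  rw [motifProbOn, motifProbOn, motifProbOn, setIntegral_univ]
  exact integral_add_compl hA (integrable_edgeProd hτ hmin_pos H n)

/-! ### One-dimensional estimates for the law of a hidden variable -/

lemma integrable_hiddenLaw {τ hmin : ℝ} (hτ : 2 < τ) (hmin_pos : 0 < hmin) {g : ℝ → ℝ}
    (hg : IntegrableOn (fun x => x ^ (-τ) * g x) (Set.Ioi hmin)) :
    Integrable g (hiddenLaw τ hmin) := by
  rw [hiddenLaw, ProbabilityTheory.paretoMeasure]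
  unfold ProbabilityTheory.paretoPDF
  rw [integrable_withDensity_iff_integrable_smul' (by fun_prop) (by simp)]
  rw [← integrableOn_Ici_iff_integrableOn_Ioi] at hg
  refine (((integrable_indicator_iff measurableSet_Ici).2 hg).const_mul
    ((τ - 1) * hmin ^ (τ - 1))).congr (Eventually.of_forall fun x => ?_)
  simp only [smul_eq_mul, Set.indicator, Set.mem_Ici]
  rw [ENNReal.toReal_ofReal
    (ProbabilityTheory.paretoPDFReal_nonneg hmin_pos.le (by linarith) x)]
  unfold ProbabilityTheory.paretoPDFReal
  split_ifs <;> ring_nf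

/-- The mass of an interval. -/
lemma hiddenLaw_real_Icc {τ hmin : ℝ} (hτ : 2 < τ) (hmin_pos : 0 < hmin) {a b : ℝ}
    (ha : hmin ≤ a) (hab : a ≤ b) :
    (hiddenLaw τ hmin).real (Set.Icc a b) = hmin ^ (τ - 1) * (a ^ (1 - τ) - b ^ (1 - τ)) := by
  have ha0 : 0 < a := hmin_pos.trans_le ha
  have h0 : (0 : ℝ) ∉ Set.uIcc a b := by
    rw [Set.uIcc_of_le hab]; exact fun h => ha0.not_ge h.1
  have hτ1 : τ - 1 ≠ 0 := by linarith
  have := isProbabilityMeasure_hiddenLaw hτ hmin_pos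
  have h1 := setIntegral_hiddenLaw hτ hmin_pos (measurableSet_Icc (a := a) (b := b)) fun _ => 1
  rw [setIntegral_const, smul_eq_mul, mul_one] at h1
  have h2 : ∫ x in Set.Icc a b, ProbabilityTheory.paretoPDFReal hmin (τ - 1) x * 1 =
      ∫ x in Set.Icc a b, (τ - 1) * hmin ^ (τ - 1) * x ^ (-τ) := by
    refine setIntegral_congr_fun measurableSet_Icc fun x hx => ?_
    simp only [ProbabilityTheory.paretoPDFReal, if_pos (ha.trans hx.1), mul_one]
    ring_nf
  rw [h1, h2, integral_Icc_eq_integral_Ioc, ← intervalIntegral.integral_of_le hab,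
    intervalIntegral.integral_const_mul, integral_rpow (Or.inr ⟨by linarith, h0⟩),
    show -τ + 1 = -(τ - 1) by ring, show 1 - τ = -(τ - 1) by ring]
  field_simp
  ring

/-- The two-sided exponential weight around the logarithmic scale `ℓ`. -/
def scaleWeight (τ a ℓ x : ℝ) : ℝ := Real.exp ((τ - 1) * (Real.log x - ℓ) - a * |Real.log x - ℓ|)

lemma scaleWeight_nonneg (τ a ℓ x : ℝ) : 0 ≤ scaleWeight τ a ℓ x := (Real.exp_pos _).le

lemma rpow_mul_scaleWeight_of_le {τ a ℓ x : ℝ} (hx : 0 < x) (h : Real.log x ≤ ℓ) :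
    x ^ (-τ) * scaleWeight τ a ℓ x = Real.exp ((1 - τ - a) * ℓ) * x ^ (a - 1) := by
  rw [scaleWeight, abs_of_nonpos (by linarith), Real.rpow_def_of_pos hx, Real.rpow_def_of_pos hx,
    ← Real.exp_add, ← Real.exp_add]
  ring_nf

lemma rpow_mul_scaleWeight_of_ge {τ a ℓ x : ℝ} (hx : 0 < x) (h : ℓ ≤ Real.log x) :
    x ^ (-τ) * scaleWeight τ a ℓ x = Real.exp ((1 - τ + a) * ℓ) * x ^ (-a - 1) := by
  rw [scaleWeight, abs_of_nonneg (by linarith), Real.rpow_def_of_pos hx, Real.rpow_def_of_pos hx,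
    ← Real.exp_add, ← Real.exp_add]
  ring_nf

/-- In the variable `u = log x` the integrand is `exp ((1 - τ) ℓ) * exp (-a |u - ℓ|) du`, so each
side of `ℓ` contributes `1 / a`. -/
lemma integrableOn_scaleWeight (τ : ℝ) {a : ℝ} (ha : 0 < a) (ℓ : ℝ) :
    IntegrableOn (fun x => x ^ (-τ) * scaleWeight τ a ℓ x) (Set.Ioi 0) ∧
      ∫ x in Set.Ioi (0 : ℝ), x ^ (-τ) * scaleWeight τ a ℓ x =
        2 / a * Real.exp ((1 - τ) * ℓ) := by
  have hv : 0 < Real.exp ℓ := Real.exp_pos _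
  have hle : Set.EqOn (fun x => x ^ (-τ) * scaleWeight τ a ℓ x)
      (fun x => Real.exp ((1 - τ - a) * ℓ) * x ^ (a - 1)) (Set.Ioc 0 (Real.exp ℓ)) := fun x hx =>
    rpow_mul_scaleWeight_of_le hx.1 ((Real.log_le_iff_le_exp hx.1).2 hx.2)
  have hge : Set.EqOn (fun x => x ^ (-τ) * scaleWeight τ a ℓ x)
      (fun x => Real.exp ((1 - τ + a) * ℓ) * x ^ (-a - 1)) (Set.Ioi (Real.exp ℓ)) := fun x hx =>
    rpow_mul_scaleWeight_of_ge (hv.trans hx) ((Real.le_log_iff_exp_le (hv.trans hx)).2 (le_of_lt hx))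
  have hi1 : IntegrableOn (fun x : ℝ => x ^ (a - 1)) (Set.Ioc 0 (Real.exp ℓ)) :=
    (intervalIntegrable_iff_integrableOn_Ioc_of_le hv.le).1
      (intervalIntegral.intervalIntegrable_rpow' (by linarith))
  have hi2 := integrableOn_Ioi_rpow_of_lt (show -a - 1 < -1 by linarith) hv
  have hj1 := IntegrableOn.congr_fun (hi1.const_mul (Real.exp ((1 - τ - a) * ℓ))) hle.symm
    measurableSet_Ioc
  have hj2 := IntegrableOn.congr_fun (hi2.const_mul (Real.exp ((1 - τ + a) * ℓ))) hge.symm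
    measurableSet_Ioi
  rw [← Set.Ioc_union_Ioi_eq_Ioi hv.le]
  refine ⟨hj1.union hj2, ?_⟩
  rw [setIntegral_union Set.Ioc_disjoint_Ioi_same measurableSet_Ioi hj1 hj2,
    setIntegral_congr_fun measurableSet_Ioc hle, setIntegral_congr_fun measurableSet_Ioi hge,
    integral_const_mul, integral_const_mul, integral_Ioi_rpow_of_lt (by linarith) hv,
    ← intervalIntegral.integral_of_le hv.le, integral_rpow (Or.inl (by linarith)),
    sub_add_cancel, sub_add_cancel, Real.zero_rpow ha.ne', ← Real.exp_mul, ← Real.exp_mul, sub_zero,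
    neg_div_neg_eq, ← mul_div_assoc, ← mul_div_assoc, ← Real.exp_add, ← Real.exp_add]
  ring_nf

lemma integrable_scaleWeight {τ hmin : ℝ} (hτ : 2 < τ) (hmin_pos : 0 < hmin) {a : ℝ} (ha : 0 < a)
    (ℓ : ℝ) : Integrable (scaleWeight τ a ℓ) (hiddenLaw τ hmin) :=
  integrable_hiddenLaw hτ hmin_pos
    ((integrableOn_scaleWeight τ ha ℓ).1.mono_set (Set.Ioi_subset_Ioi hmin_pos.le))

lemma integral_scaleWeight_le {τ hmin : ℝ} (hτ : 2 < τ) (hmin_pos : 0 < hmin) {a : ℝ} (ha : 0 < a)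
    (ℓ : ℝ) : ∫ x, scaleWeight τ a ℓ x ∂(hiddenLaw τ hmin) ≤
      (τ - 1) * hmin ^ (τ - 1) * (2 / a) * Real.exp ((1 - τ) * ℓ) := by
  have h1 : 0 ≤ τ - 1 := by linarith
  rw [integral_hiddenLaw hτ hmin_pos, mul_assoc _ (2 / a), ← (integrableOn_scaleWeight τ ha ℓ).2]
  refine mul_le_mul_of_nonneg_left (setIntegral_mono_set (integrableOn_scaleWeight τ ha ℓ).1 ?_
    (Set.Ioi_subset_Ioi hmin_pos.le).eventuallyLE) (by positivity)
  filter_upwards [ae_restrict_mem measurableSet_Ioi] with x hx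
  exact mul_nonneg (Real.rpow_nonneg (le_of_lt hx) _) (scaleWeight_nonneg _ _ _ _)

/-! ### The upper bound -/

/-- The exponent of `n` in the order of the edge product at the profile of a partition. -/
def edgeExponent {k : ℕ} (H : SimpleGraph (Fin k)) (P : VertexPartition k) : ℝ :=
  ∑ q ∈ edgePairs H, min ((P q.1).sign + (P q.2).sign) 0 / 2

lemma Bf_eq {τ : ℝ} {k : ℕ} {H : SimpleGraph (Fin k)} {P : VertexPartition k}
    (hopt : IsOptimal τ H P) : Bf τ H = objective τ H P := by
  have : Nonempty (VertexPartition k) := ⟨P⟩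
  exact le_antisymm (ciSup_le hopt) (le_ciSup ⟨_, Set.forall_mem_range.2 hopt⟩ P)

/-- The exponent splits into `k` for the choice of vertices, `edgeExponent` for the edges, and `(1 -
τ) α i` for the probability that a hidden variable has order `n ^ α i`. -/
lemma growthExponent_eq {τ : ℝ} (hτ : 2 < τ) {k : ℕ} {H : SimpleGraph (Fin k)}
    {P : VertexPartition k} (hopt : IsOptimal τ H P) :
    growthExponent τ H = k + (edgeExponent H P + (1 - τ) * ∑ i, profile P i) := by
  have h := logWeight_sign hτ H P
  rw [logWeight] at h
  have h1 : ∑ i, profile P i = k / 2 + (∑ i, (P i).sign) / 2 := by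
    simp only [profile, Part.exponent_eq, Finset.sum_add_distrib, Finset.sum_div]
    simp
    ring
  rw [growthExponent, Bf_eq hopt, edgeExponent, ← Finset.sum_div, h1]
  linarith

/-- Centring each logarithm at half of `log (μ n)` absorbs the denominator evenly into both ends and
turns the cap at `1` into a cap at `0`. -/
lemma connProb_eq_exp {τ hmin : ℝ} (hτ : 2 < τ) (hmin_pos : 0 < hmin) {n : ℕ} (hn : 0 < n) {x y : ℝ}
    (hx : 0 < x) (hy : 0 < y) : connProb τ hmin n x y =
      Real.exp (min ((Real.log x - Real.log (meanHidden τ hmin * n) / 2) +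
        (Real.log y - Real.log (meanHidden τ hmin * n) / 2)) 0) := by
  have hμ := meanHidden_pos hτ hmin_pos
  have hn' : (0 : ℝ) < n := Nat.cast_pos.2 hn
  have hN : 0 < meanHidden τ hmin * n := by positivity
  rw [Real.exp_monotone.map_min, Real.exp_zero, connProb]
  congr 1
  rw [show (Real.log x - Real.log (meanHidden τ hmin * n) / 2) +
        (Real.log y - Real.log (meanHidden τ hmin * n) / 2) =
      Real.log x + Real.log y - Real.log (meanHidden τ hmin * n) by ring, Real.exp_sub, Real.exp_add,
    Real.exp_log hx, Real.exp_log hy, Real.exp_log hN]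

lemma edgeProd_eq_exp {τ hmin : ℝ} (hτ : 2 < τ) (hmin_pos : 0 < hmin) {k : ℕ}
    (H : SimpleGraph (Fin k)) {n : ℕ} (hn : 0 < n) {h : Fin k → ℝ} (hh : ∀ i, hmin ≤ h i)
    {y : Fin k → ℝ} (hy : ∀ i, y i = Real.log (h i) - Real.log (meanHidden τ hmin * n) / 2) :
    edgeProd τ hmin H n h = Real.exp (logWeight τ H y + (τ - 1) * ∑ i, y i) := by
  have : logWeight τ H y + (τ - 1) * ∑ i, y i = ∑ q ∈ edgePairs H, min (y q.1 + y q.2) 0 := by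
    rw [logWeight]; ring
  rw [this, Real.exp_sum, edgeProd]
  refine Finset.prod_congr rfl fun q _ => ?_
  rw [connProb_eq_exp hτ hmin_pos hn (hmin_pos.trans_le (hh _)) (hmin_pos.trans_le (hh _)), hy, hy]

/-- The edge product decays exponentially in the logarithmic distance to the optimal profile. -/
theorem exists_edgeProd_le {τ hmin : ℝ} (hτ : 2 < τ) (hmin_pos : 0 < hmin) {k : ℕ}
    {H : SimpleGraph (Fin k)} {P : VertexPartition k} (hopt : IsOptimal τ H P)
    (huniq : ∀ Q, IsOptimal τ H Q → Q = P) :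
    ∃ a K : ℝ, 0 < a ∧ 0 < K ∧ ∀ᶠ n : ℕ in atTop, ∀ h : Fin k → ℝ, (∀ i, hmin ≤ h i) →
      edgeProd τ hmin H n h ≤ K * (n : ℝ) ^ edgeExponent H P *
        Real.exp (-∑ i, |Real.log (h i) - profile P i * Real.log n|) ^ a *
          ∏ i, scaleWeight τ a (profile P i * Real.log n) (h i) := by
  obtain ⟨c, hc, hmain⟩ := exists_logWeight_le hτ hopt huniq
  have hμ := meanHidden_pos hτ hmin_pos
  set m := Real.log (meanHidden τ hmin) with hm
  set L₀ := m / 2 - Real.log hmin with hL₀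
  set A := (τ - 1) * objective τ H P with hA
  -- Half of the decay rate `c` goes to the distance factor, half makes `scaleWeight` integrable.
  -- The constant collects the errors bounded in `n`: `L₀ * A` from `L - ℓ / 2`, the sum from the
  -- displaced centre, and the last term from the centring by `m / 2`.
  refine ⟨c / 2, Real.exp (L₀ * A + c * ∑ i, |m / 2 + L₀ * (P i).sign| - (τ - 1) * (k * (m / 2))),
    by positivity, Real.exp_pos _, ?_⟩
  have hL : ∀ᶠ n : ℕ in atTop, 0 ≤ Real.log n / 2 + L₀ := by
    have h1 : Tendsto (fun n : ℕ => Real.log n / 2 + L₀) atTop atTop :=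
      tendsto_atTop_add_const_right _ _
        ((Real.tendsto_log_atTop.comp tendsto_natCast_atTop_atTop).atTop_div_const two_pos)
    exact h1.eventually_ge_atTop 0
  filter_upwards [hL, eventually_gt_atTop 0] with n hL hn h hh
  have hn' : (0 : ℝ) < n := Nat.cast_pos.2 hn
  set ℓ := Real.log n with hℓ
  have hlogN : Real.log (meanHidden τ hmin * n) = m + ℓ := Real.log_mul hμ.ne' hn'.ne'
  set d : Fin k → ℝ := fun i => Real.log (h i) - profile P i * ℓ with hd
  set y : Fin k → ℝ := fun i => Real.log (h i) - Real.log (meanHidden τ hmin * n) / 2 with hy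
  have hyd : ∀ i, y i = d i + ℓ / 2 * (P i).sign - m / 2 := by
    intro i
    simp only [hy, hd, hlogN, profile, Part.exponent_eq]
    ring
  -- The cutoff `hmin` is what fixes `L₀`.
  have hyL : ∀ i, -(ℓ / 2 + L₀) ≤ y i := by
    intro i
    have := Real.log_le_log hmin_pos (hh i)
    simp only [hy, hlogN, hL₀]
    linarith
  have hW := hmain _ hL y hyL
  have hdist : ∀ i, |d i| - |m / 2 + L₀ * (P i).sign| ≤ |y i - (ℓ / 2 + L₀) * (P i).sign| := by
    intro i
    rw [hyd, show d i + ℓ / 2 * (P i).sign - m / 2 - (ℓ / 2 + L₀) * (P i).sign =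
      d i - (m / 2 + L₀ * (P i).sign) by ring]
    exact abs_sub_abs_le_abs_sub _ _
  have hdsum := Finset.sum_le_sum fun i (_ : i ∈ Finset.univ) => hdist i
  rw [Finset.sum_sub_distrib] at hdsum
  have hysum : ∑ i, y i = ∑ i, d i + ℓ / 2 * ∑ i, (P i).sign - k * (m / 2) := by
    simp only [hyd, Finset.sum_sub_distrib, Finset.sum_add_distrib, Finset.mul_sum]
    simp
  have hD : edgeExponent H P = (A + (τ - 1) * ∑ i, (P i).sign) / 2 := by
    rw [hA, ← logWeight_sign hτ, logWeight, edgeExponent, ← Finset.sum_div]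
    ring
  rw [edgeProd_eq_exp hτ hmin_pos H hn hh (y := y) fun i => rfl, Real.rpow_def_of_pos hn',
    ← Real.exp_mul]
  simp only [scaleWeight]
  rw [← Real.exp_sum, ← Real.exp_add, ← Real.exp_add, ← Real.exp_add, Real.exp_le_exp]
  change _ ≤ _ + ℓ * _ + -(∑ i, |d i|) * _ + ∑ i, ((τ - 1) * d i - c / 2 * |d i|)
  have hsw : ∑ i, ((τ - 1) * d i - c / 2 * |d i|) = (τ - 1) * ∑ i, d i - c / 2 * ∑ i, |d i| := by
    rw [Finset.sum_sub_distrib, Finset.mul_sum, Finset.mul_sum]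
  rw [hsw, hysum, hD]
  have := mul_le_mul_of_nonneg_left hdsum hc.le
  linarith

/-- The contribution of hidden variables at a given distance from the optimal profile. -/
theorem exists_motifProbOn_le {τ hmin : ℝ} (hτ : 2 < τ) (hmin_pos : 0 < hmin) {k : ℕ}
    {H : SimpleGraph (Fin k)} {P : VertexPartition k} (hopt : IsOptimal τ H P)
    (huniq : ∀ Q, IsOptimal τ H Q → Q = P) :
    ∃ a K : ℝ, 0 < a ∧ 0 < K ∧ ∀ᶠ n : ℕ in atTop, ∀ t : ℝ, ∀ B : Set (Fin k → ℝ),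
      MeasurableSet B → (∀ h ∈ B, (∀ i, hmin ≤ h i) →
        Real.exp (-∑ i, |Real.log (h i) - profile P i * Real.log n|) ≤ t) →
      0 ≤ t → motifProbOn τ hmin H n B ≤ K * t ^ a * (n : ℝ) ^ (growthExponent τ H - k) := by
  obtain ⟨a, K, ha, hK, hev⟩ := exists_edgeProd_le hτ hmin_pos hopt huniq
  have hτ1 : 0 < τ - 1 := by linarith
  have := isProbabilityMeasure_hiddenLaw hτ hmin_pos
  refine ⟨a, K * ((τ - 1) * hmin ^ (τ - 1) * (2 / a)) ^ k, ha, by positivity, ?_⟩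
  filter_upwards [hev, eventually_gt_atTop 0] with n hn hn0 t B hB hBt ht
  have hn' : (0 : ℝ) < n := Nat.cast_pos.2 hn0
  set G : (Fin k → ℝ) → ℝ := fun h => ∏ i, scaleWeight τ a (profile P i * Real.log n) (h i) with hG
  have hG0 : ∀ h, 0 ≤ G h := fun h => Finset.prod_nonneg fun i _ => scaleWeight_nonneg _ _ _ _
  have hGint : Integrable G (Measure.pi fun _ : Fin k => hiddenLaw τ hmin) :=
    Integrable.fintype_prod fun i => integrable_scaleWeight hτ hmin_pos ha _
  have hc : 0 ≤ K * (n : ℝ) ^ edgeExponent H P * t ^ a := by positivity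
  have h1 : motifProbOn τ hmin H n B ≤
      ∫ h in B, K * (n : ℝ) ^ edgeExponent H P * t ^ a * G h
        ∂(Measure.pi fun _ : Fin k => hiddenLaw τ hmin) := by
    refine integral_mono_ae (integrable_edgeProd hτ hmin_pos H n).integrableOn
      (hGint.const_mul _).integrableOn ?_
    filter_upwards [ae_restrict_mem hB,
      ae_restrict_of_ae (pi_hiddenLaw_ae_le hτ hmin_pos (Fin k))] with h hhB hh
    -- On `B` the distance factor is at most `t ^ a`; the remaining product separates over the
    -- vertices.
    refine (hn h hh).trans (mul_le_mul_of_nonneg_right ?_ (hG0 h))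
    exact mul_le_mul_of_nonneg_left
      (Real.rpow_le_rpow (Real.exp_pos _).le (hBt h hhB hh) ha.le) (by positivity)
  have h2 : ∫ h in B, K * (n : ℝ) ^ edgeExponent H P * t ^ a * G h
        ∂(Measure.pi fun _ : Fin k => hiddenLaw τ hmin) ≤
      K * (n : ℝ) ^ edgeExponent H P * t ^ a *
        ∫ h, G h ∂(Measure.pi fun _ : Fin k => hiddenLaw τ hmin) := by
    rw [integral_const_mul]
    exact mul_le_mul_of_nonneg_left
      (setIntegral_le_integral hGint (Eventually.of_forall hG0)) hc
  have h3 : ∫ h, G h ∂(Measure.pi fun _ : Fin k => hiddenLaw τ hmin) ≤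
      ((τ - 1) * hmin ^ (τ - 1) * (2 / a)) ^ k * (n : ℝ) ^ ((1 - τ) * ∑ i, profile P i) := by
    rw [hG, integral_fintype_prod_eq_prod]
    refine (Finset.prod_le_prod (fun i _ => integral_nonneg fun x => scaleWeight_nonneg _ _ _ _)
      fun i _ => integral_scaleWeight_le hτ hmin_pos ha _).trans_eq ?_
    rw [Finset.prod_mul_distrib, ← Real.exp_sum, Real.rpow_def_of_pos hn', Finset.mul_sum,
      Finset.mul_sum]
    simp only [Finset.prod_const, Finset.card_univ, Fintype.card_fin]
    congr 3
    funext i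
    ring
  refine (h1.trans h2).trans ((mul_le_mul_of_nonneg_left h3 hc).trans_eq ?_)
  rw [growthExponent_eq hτ hopt, add_sub_cancel_left, Real.rpow_add hn']
  ring

/-! ### The optimal window -/

lemma connProb_window_bounds {τ hmin : ℝ} (hτ : 2 < τ) (hmin_pos : 0 < hmin) {n : ℕ} (hn : 0 < n)
    {ε a b x y : ℝ} (hε : 0 < ε)
    (hx : x ∈ Set.Icc (ε * (n : ℝ) ^ a) (1 / ε * (n : ℝ) ^ a))
    (hy : y ∈ Set.Icc (ε * (n : ℝ) ^ b) (1 / ε * (n : ℝ) ^ b)) :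
    min (ε ^ 2 / meanHidden τ hmin) 1 * (n : ℝ) ^ min (a + b - 1) 0 ≤ connProb τ hmin n x y ∧
      connProb τ hmin n x y ≤
        max (1 / (ε ^ 2 * meanHidden τ hmin)) 1 * (n : ℝ) ^ min (a + b - 1) 0 := by
  have hμ := meanHidden_pos hτ hmin_pos
  have hn' : (0 : ℝ) < n := Nat.cast_pos.2 hn
  have hr : (0 : ℝ) < (n : ℝ) ^ (a + b - 1) := Real.rpow_pos_of_pos hn' _
  have hmin' : (n : ℝ) ^ min (a + b - 1) 0 = min ((n : ℝ) ^ (a + b - 1)) 1 := by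
    rw [(Real.monotone_rpow_of_base_ge_one (Nat.one_le_cast.2 hn)).map_min, Real.rpow_zero]
  have hab : (n : ℝ) ^ a * (n : ℝ) ^ b = (n : ℝ) ^ (a + b - 1) * n := by
    rw [← Real.rpow_add hn', ← Real.rpow_add_one hn'.ne']; ring_nf
  have hna := Real.rpow_pos_of_pos hn' a
  have hnb := Real.rpow_pos_of_pos hn' b
  have hx0 : 0 < x := lt_of_lt_of_le (by positivity) hx.1
  have hlow : ε ^ 2 / meanHidden τ hmin * (n : ℝ) ^ (a + b - 1) ≤
      x * y / (meanHidden τ hmin * n) := by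
    have := mul_le_mul hx.1 hy.1 (by positivity) hx0.le
    rw [le_div_iff₀ (by positivity)]
    calc _ = ε ^ 2 * ((n : ℝ) ^ (a + b - 1) * n) := by field_simp
      _ = (ε * (n : ℝ) ^ a) * (ε * (n : ℝ) ^ b) := by rw [← hab]; ring
      _ ≤ _ := this
  have hup : x * y / (meanHidden τ hmin * n) ≤
      1 / (ε ^ 2 * meanHidden τ hmin) * (n : ℝ) ^ (a + b - 1) := by
    have hy0 : 0 < y := lt_of_lt_of_le (by positivity) hy.1
    have := mul_le_mul hx.2 hy.2 hy0.le (by positivity)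
    rw [div_le_iff₀ (by positivity)]
    calc _ ≤ _ := this
      _ = 1 / ε ^ 2 * ((n : ℝ) ^ a * (n : ℝ) ^ b) := by field_simp
      _ = _ := by rw [hab]; field_simp
  rw [hmin', connProb]
  constructor
  · refine le_min ((mul_le_mul (min_le_left _ _) (min_le_left _ _) (by positivity)
      (by positivity)).trans hlow) ?_
    exact mul_le_one₀ (min_le_right _ _) (by positivity) (min_le_right _ _)
  · rcases min_choice ((n : ℝ) ^ (a + b - 1)) 1 with h | h <;> rw [h]
    · exact (min_le_left _ _).trans
        (hup.trans (mul_le_mul_of_nonneg_right (le_max_left _ _) hr.le))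
    · exact (min_le_right _ _).trans (by rw [mul_one]; exact le_max_right _ _)

lemma edgeProd_window_bounds {τ hmin : ℝ} (hτ : 2 < τ) (hmin_pos : 0 < hmin) {k : ℕ}
    (H : SimpleGraph (Fin k)) (P : VertexPartition k) {n : ℕ} (hn : 0 < n) {ε : ℝ} (hε : 0 < ε)
    {h : Fin k → ℝ} (hh : h ∈ window (profile P) ε n) :
    min (ε ^ 2 / meanHidden τ hmin) 1 ^ (edgePairs H).card * (n : ℝ) ^ edgeExponent H P ≤
        edgeProd τ hmin H n h ∧
      edgeProd τ hmin H n h ≤ max (1 / (ε ^ 2 * meanHidden τ hmin)) 1 ^ (edgePairs H).card *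
        (n : ℝ) ^ edgeExponent H P := by
  have hμ := meanHidden_pos hτ hmin_pos
  have hn' : (0 : ℝ) < n := Nat.cast_pos.2 hn
  have hb := fun q : Fin k × Fin k => connProb_window_bounds hτ hmin_pos hn hε
    (Set.mem_univ_pi.1 hh q.1) (Set.mem_univ_pi.1 hh q.2)
  have hs : ∀ q : Fin k × Fin k, min (profile P q.1 + profile P q.2 - 1) 0 =
      min ((P q.1).sign + (P q.2).sign) 0 / 2 := by
    intro q
    rw [← zero_div (2 : ℝ), ← min_div_div_right (by norm_num : (0 : ℝ) ≤ 2), zero_div]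
    simp only [profile, Part.exponent_eq]
    ring_nf
  simp only [hs] at hb
  have hprod : ∀ C : ℝ, C ^ (edgePairs H).card * (n : ℝ) ^ edgeExponent H P =
      ∏ q ∈ edgePairs H, C * (n : ℝ) ^ (min ((P q.1).sign + (P q.2).sign) 0 / 2) := by
    intro C
    rw [Finset.prod_mul_distrib, Finset.prod_const, edgeExponent, Real.rpow_sum_of_pos hn']
  rw [hprod, hprod, edgeProd]
  exact ⟨Finset.prod_le_prod (fun q _ => by positivity) fun q _ => (hb q).1,
    Finset.prod_le_prod (fun q _ => le_trans (by positivity) (hb q).1) fun q _ => (hb q).2⟩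

/-- The rescaled mass of the window of width `ε` in the class `s`. -/
def classWeight (τ hmin ε : ℝ) : Part → ℝ
  | .S1 => (hiddenLaw τ hmin).real (Set.Icc ε (1 / ε))
  | _ => hmin ^ (τ - 1) * (ε ^ (1 - τ) - (1 / ε) ^ (1 - τ))

lemma classWeight_pos {τ hmin : ℝ} (hτ : 2 < τ) (hmin_pos : 0 < hmin) {k : ℕ}
    {P : VertexPartition k} {ε : ℝ} (hε : Admissible hmin P ε) (i : Fin k) :
    0 < classWeight τ hmin ε (P i) := by
  obtain ⟨h0, h1, h2⟩ := hε
  have hlt : ε < 1 / ε := h1.trans (by rw [lt_div_iff₀ h0]; linarith)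
  have hpos : 0 < hmin ^ (τ - 1) * (ε ^ (1 - τ) - (1 / ε) ^ (1 - τ)) :=
    mul_pos (by positivity) (sub_pos.2 (Real.rpow_lt_rpow_of_neg h0 hlt (by linarith)))
  rcases hP : P i with _ | _ | _
  · have := isProbabilityMeasure_hiddenLaw hτ hmin_pos
    -- Only the part of the window above `hmin` has mass; admissibility makes it a nondegenerate
    -- interval.
    have hm : max ε hmin < 1 / ε := max_lt hlt (h2 ⟨i, hP⟩)
    have hm0 : 0 < max ε hmin := lt_max_of_lt_left h0
    refine lt_of_lt_of_le ?_
      (measureReal_mono (Set.Icc_subset_Icc_left (le_max_left ε hmin)))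
    rw [hiddenLaw_real_Icc hτ hmin_pos (le_max_right _ _) hm.le]
    exact mul_pos (by positivity) (sub_pos.2 (Real.rpow_lt_rpow_of_neg hm0 hm (by linarith)))
  · exact hpos
  · exact hpos

/-- An exact equality for large `n`: on `S₂` and `S₃` the whole window eventually lies above `hmin`,
where the tail is a pure power, and on `S₁` the window does not move. -/
lemma eventually_hiddenLaw_window {τ hmin : ℝ} (hτ : 2 < τ) (hmin_pos : 0 < hmin) {ε : ℝ}
    (h0 : 0 < ε) (h1 : ε < 1) (s : Part) : ∀ᶠ n : ℕ in atTop,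
      (hiddenLaw τ hmin).real
          (Set.Icc (ε * (n : ℝ) ^ s.exponent) (1 / ε * (n : ℝ) ^ s.exponent)) =
        (n : ℝ) ^ ((1 - τ) * s.exponent) * classWeight τ hmin ε s := by
  have hlt : ε < 1 / ε := h1.trans (by rw [lt_div_iff₀ h0]; linarith)
  have key : 0 < s.exponent → ∀ᶠ n : ℕ in atTop, (hiddenLaw τ hmin).real
      (Set.Icc (ε * (n : ℝ) ^ s.exponent) (1 / ε * (n : ℝ) ^ s.exponent)) =
        (n : ℝ) ^ ((1 - τ) * s.exponent) *
          (hmin ^ (τ - 1) * (ε ^ (1 - τ) - (1 / ε) ^ (1 - τ))) := by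
    intro hs
    have ht : Tendsto (fun n : ℕ => ε * (n : ℝ) ^ s.exponent) atTop atTop :=
      ((tendsto_rpow_atTop hs).comp tendsto_natCast_atTop_atTop).const_mul_atTop h0
    filter_upwards [ht.eventually_ge_atTop hmin, eventually_gt_atTop 0] with n hn hn0
    have hn' : (0 : ℝ) < n := Nat.cast_pos.2 hn0
    rw [hiddenLaw_real_Icc hτ hmin_pos hn (mul_le_mul_of_nonneg_right hlt.le (by positivity)),
      Real.mul_rpow h0.le (by positivity), Real.mul_rpow (by positivity) (by positivity),
      ← Real.rpow_mul hn'.le, mul_comm s.exponent]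
    ring
  cases s
  · exact Eventually.of_forall fun n => by simp [Part.exponent, classWeight]
  · exact key (by norm_num [Part.exponent])
  · exact key (by norm_num [Part.exponent])

/-- The rescaled mass of the optimal window. -/
def windowWeight (τ hmin : ℝ) {k : ℕ} (P : VertexPartition k) (ε : ℝ) : ℝ :=
  ∏ i, classWeight τ hmin ε (P i)

lemma windowWeight_pos {τ hmin : ℝ} (hτ : 2 < τ) (hmin_pos : 0 < hmin) {k : ℕ}
    {P : VertexPartition k} {ε : ℝ} (hε : Admissible hmin P ε) : 0 < windowWeight τ hmin P ε :=
  Finset.prod_pos fun i _ => classWeight_pos hτ hmin_pos hε i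

lemma eventually_pi_window {τ hmin : ℝ} (hτ : 2 < τ) (hmin_pos : 0 < hmin) {k : ℕ}
    (P : VertexPartition k) {ε : ℝ} (h0 : 0 < ε) (h1 : ε < 1) : ∀ᶠ n : ℕ in atTop,
      (Measure.pi fun _ : Fin k => hiddenLaw τ hmin).real (window (profile P) ε n) =
        (n : ℝ) ^ ((1 - τ) * ∑ i, profile P i) * windowWeight τ hmin P ε := by
  have := isProbabilityMeasure_hiddenLaw hτ hmin_pos
  filter_upwards [eventually_all.2 fun i => eventually_hiddenLaw_window hτ hmin_pos h0 h1 (P i),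
    eventually_gt_atTop 0] with n hn hn0
  have hn' : (0 : ℝ) < n := Nat.cast_pos.2 hn0
  rw [measureReal_def, window, Measure.pi_pi, ENNReal.toReal_prod, windowWeight, Finset.mul_sum,
    Real.rpow_sum_of_pos hn', ← Finset.prod_mul_distrib]
  exact Finset.prod_congr rfl fun i _ => hn i

lemma window_anti {k : ℕ} (α : Fin k → ℝ) {ε ε' : ℝ} (h0 : 0 < ε) (h : ε ≤ ε') (n : ℕ) :
    window α ε' n ⊆ window α ε n :=
  Set.pi_mono fun i _ => Set.Icc_subset_Icc (by gcongr) (by gcongr)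

/-- Inside a fixed optimal window, smaller optimal windows carry an amount of exact order
`windowWeight`. -/
theorem eventually_motifProbOn_window_bounds {τ hmin : ℝ} (hτ : 2 < τ) (hmin_pos : 0 < hmin) {k : ℕ}
    {H : SimpleGraph (Fin k)} {P : VertexPartition k} (hopt : IsOptimal τ H P) {ε₁ ε : ℝ}
    (h0 : 0 < ε₁) (hle : ε₁ ≤ ε) (h1 : ε < 1) : ∀ᶠ n : ℕ in atTop,
      min (ε₁ ^ 2 / meanHidden τ hmin) 1 ^ (edgePairs H).card * windowWeight τ hmin P ε *
          (n : ℝ) ^ (growthExponent τ H - k) ≤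
        motifProbOn τ hmin H n (window (profile P) ε n) ∧
      motifProbOn τ hmin H n (window (profile P) ε n) ≤
        max (1 / (ε₁ ^ 2 * meanHidden τ hmin)) 1 ^ (edgePairs H).card * windowWeight τ hmin P ε *
          (n : ℝ) ^ (growthExponent τ H - k) := by
  have := isProbabilityMeasure_hiddenLaw hτ hmin_pos
  filter_upwards [eventually_pi_window hτ hmin_pos P (h0.trans_le hle) h1, eventually_gt_atTop 0]
    with n hn hn0
  have hn' : (0 : ℝ) < n := Nat.cast_pos.2 hn0
  have hm := measurableSet_window (profile P) ε n
  have hb := fun h (hh : h ∈ window (profile P) ε n) =>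
    edgeProd_window_bounds hτ hmin_pos H P hn0 h0 (window_anti (profile P) h0 hle n hh)
  have hint := (integrable_edgeProd hτ hmin_pos H n).integrableOn (s := window (profile P) ε n)
  have hconst : ∀ c : ℝ, c * windowWeight τ hmin P ε * (n : ℝ) ^ (growthExponent τ H - k) =
      ∫ _ in window (profile P) ε n, c * (n : ℝ) ^ edgeExponent H P
        ∂(Measure.pi fun _ : Fin k => hiddenLaw τ hmin) := by
    intro c
    rw [setIntegral_const, hn, growthExponent_eq hτ hopt, add_sub_cancel_left, Real.rpow_add hn',
      smul_eq_mul]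
    ring
  rw [hconst, hconst, motifProbOn]
  exact ⟨setIntegral_mono_on (integrable_const _).integrableOn hint hm fun h hh => (hb h hh).1,
    setIntegral_mono_on hint (integrable_const _).integrableOn hm fun h hh => (hb h hh).2⟩

lemma exists_admissible {hmin : ℝ} (hmin_pos : 0 < hmin) {k : ℕ} (P : VertexPartition k) :
    ∃ ε, Admissible hmin P ε := by
  refine ⟨1 / (hmin + 2), by positivity, ?_, fun _ => by rw [one_div_one_div]; linarith⟩
  rw [div_lt_one (by positivity)]
  linarith

lemma exists_le_motifProbOn_window {τ hmin : ℝ} (hτ : 2 < τ) (hmin_pos : 0 < hmin) {k : ℕ}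
    {H : SimpleGraph (Fin k)} {P : VertexPartition k} (hopt : IsOptimal τ H P) {ε : ℝ}
    (hε : Admissible hmin P ε) : ∃ c : ℝ, 0 < c ∧ ∀ᶠ n : ℕ in atTop,
      c * (n : ℝ) ^ (growthExponent τ H - k) ≤
        motifProbOn τ hmin H n (window (profile P) ε n) := by
  have hμ := meanHidden_pos hτ hmin_pos
  have h0 := hε.1
  refine ⟨min (ε ^ 2 / meanHidden τ hmin) 1 ^ (edgePairs H).card * windowWeight τ hmin P ε,
    mul_pos (by positivity) (windowWeight_pos hτ hmin_pos hε), ?_⟩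
  filter_upwards [eventually_motifProbOn_window_bounds hτ hmin_pos hopt h0 le_rfl hε.2.1] with n hn
  exact hn.1

/-- The order of the optimal windows, up to constants that do not depend on the window. -/
theorem exists_motifProbOn_window_order {τ hmin : ℝ} (hτ : 2 < τ) (hmin_pos : 0 < hmin) {k : ℕ}
    {H : SimpleGraph (Fin k)} {P : VertexPartition k} (hopt : IsOptimal τ H P)
    (huniq : ∀ Q, IsOptimal τ H Q → Q = P) :
    ∃ (f : ℝ → ℝ) (c C : ℝ), 0 < c ∧ 0 < C ∧ ∀ ε : ℝ, Admissible hmin P ε → 0 < f ε ∧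
      ∀ᶠ n : ℕ in atTop,
        c * f ε * (n : ℝ) ^ (growthExponent τ H - k) ≤
          motifProbOn τ hmin H n (window (profile P) ε n) ∧
        motifProbOn τ hmin H n (window (profile P) ε n) ≤
          C * f ε * (n : ℝ) ^ (growthExponent τ H - k) := by
  classical
  obtain ⟨a, K, -, hK, hup⟩ := exists_motifProbOn_le hτ hmin_pos hopt huniq
  obtain ⟨ε₁, hε₁⟩ := exists_admissible hmin_pos P
  obtain ⟨c₁, hc₁, hlow⟩ := exists_le_motifProbOn_window hτ hmin_pos hopt hε₁
  have hμ := meanHidden_pos hτ hmin_pos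
  have h0 := hε₁.1
  set m := min (ε₁ ^ 2 / meanHidden τ hmin) 1 ^ (edgePairs H).card with hm
  set M := max (1 / (ε₁ ^ 2 * meanHidden τ hmin)) 1 ^ (edgePairs H).card with hM
  have hm0 : 0 < m := by positivity
  have hM0 : 0 < M := by positivity
  -- The edge bounds degenerate as `ε → 0`, so `f` is cut at a fixed admissible `ε₁`. Below it, the
  -- window contains the `ε₁`-window and its share is at most the bound on the total, so `f = 1`
  -- works. From `ε₁` on, the edge constants of `ε₁` serve all windows and only the mass
  -- `windowWeight` varies.
  refine ⟨fun ε => if ε < ε₁ then 1 else windowWeight τ hmin P ε, min c₁ m, max K M,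
    by positivity, by positivity, fun ε hε => ?_⟩
  by_cases hlt : ε < ε₁
  · simp only [if_pos hlt, mul_one]
    refine ⟨one_pos, ?_⟩
    filter_upwards [hlow, hup] with n h1 h2
    constructor
    · refine (mul_le_mul_of_nonneg_right (min_le_left _ _) (by positivity)).trans (h1.trans ?_)
      exact motifProbOn_mono hτ hmin_pos H n (window_anti _ hε.1 hlt.le n)
    · refine (h2 1 _ (measurableSet_window _ _ _) (fun h _ _ => ?_) zero_le_one).trans ?_
      · rw [Real.exp_le_one_iff, neg_nonpos]
        exact Finset.sum_nonneg fun i _ => abs_nonneg _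
      · rw [Real.one_rpow, mul_one]
        exact mul_le_mul_of_nonneg_right (le_max_left _ _) (by positivity)
  · simp only [if_neg hlt]
    have hw := windowWeight_pos hτ hmin_pos hε
    refine ⟨hw, ?_⟩
    filter_upwards [eventually_motifProbOn_window_bounds hτ hmin_pos hopt h0 (not_lt.1 hlt) hε.2.1]
      with n hn
    refine ⟨le_trans ?_ hn.1, hn.2.trans ?_⟩
    · gcongr
      exact min_le_right _ _
    · gcongr
      exact le_max_right _ _

/-! ### Contributions away from the optimal window, and the total order -/

lemma exp_neg_sum_abs_le {k : ℕ} {d : Fin k → ℝ} {i : Fin k} {b : ℝ} (h : b ≤ |d i|) :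
    Real.exp (-∑ j, |d j|) ≤ Real.exp (-b) :=
  Real.exp_le_exp.2 (neg_le_neg (h.trans
    (Finset.single_le_sum (fun j _ => abs_nonneg (d j)) (Finset.mem_univ i))))

/-- A point of a window is close to its profile on the logarithmic scale. -/
lemma abs_log_sub_le_of_mem {n : ℕ} (hn : 0 < n) {ε a x : ℝ} (hε : 0 < ε)
    (hx : x ∈ Set.Icc (ε * (n : ℝ) ^ a) (1 / ε * (n : ℝ) ^ a)) :
    |Real.log x - a * Real.log n| ≤ -Real.log ε := by
  have hn' : (0 : ℝ) < n := Nat.cast_pos.2 hn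
  have hx0 : 0 < x := lt_of_lt_of_le (by positivity) hx.1
  have h1 := Real.log_le_log (by positivity) hx.1
  have h2 := Real.log_le_log hx0 hx.2
  rw [Real.log_mul hε.ne' (by positivity), Real.log_rpow hn'] at h1
  rw [Real.log_mul (by positivity) (by positivity), Real.log_rpow hn', one_div, Real.log_inv] at h2
  exact abs_le.2 ⟨by linarith, by linarith⟩

lemma le_abs_log_sub_of_notMem {n : ℕ} (hn : 0 < n) {ε a x : ℝ} (hε : 0 < ε) (hx0 : 0 < x)
    (hx : x ∉ Set.Icc (ε * (n : ℝ) ^ a) (1 / ε * (n : ℝ) ^ a)) :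
    -Real.log ε ≤ |Real.log x - a * Real.log n| := by
  have hn' : (0 : ℝ) < n := Nat.cast_pos.2 hn
  by_contra! h
  obtain ⟨h1, h2⟩ := abs_lt.1 h
  refine hx ⟨?_, ?_⟩
  · rw [← Real.log_le_log_iff (by positivity) hx0, Real.log_mul hε.ne' (by positivity),
      Real.log_rpow hn']
    linarith
  · rw [← Real.log_le_log_iff hx0 (by positivity), Real.log_mul (by positivity) (by positivity),
      Real.log_rpow hn', one_div, Real.log_inv]
    linarith

/-- Windows of other profiles carry a polynomially smaller amount. -/
theorem exists_motifProbOn_window_le {τ hmin : ℝ} (hτ : 2 < τ) (hmin_pos : 0 < hmin) {k : ℕ}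
    {H : SimpleGraph (Fin k)} {P : VertexPartition k} (hopt : IsOptimal τ H P)
    (huniq : ∀ Q, IsOptimal τ H Q → Q = P) {α : Fin k → ℝ} (hα : α ≠ profile P) :
    ∃ η : ℝ, 0 < η ∧ ∀ ε : ℝ, 0 < ε → ∃ K : ℝ, 0 < K ∧ ∀ᶠ n : ℕ in atTop,
      motifProbOn τ hmin H n (window α ε n) ≤
        K * (n : ℝ) ^ (-η) * (n : ℝ) ^ (growthExponent τ H - k) := by
  obtain ⟨a, K, ha, hK, hup⟩ := exists_motifProbOn_le hτ hmin_pos hopt huniq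
  obtain ⟨i, hi⟩ := Function.ne_iff.1 hα
  have hΔ : 0 < |α i - profile P i| := abs_pos.2 (sub_ne_zero.2 hi)
  -- At a coordinate `i` where the profiles differ, the window of `α` is at logarithmic distance at
  -- least `|α i - profile P i| * log n + log ε` from the optimal one, so `ε` enters only the
  -- constant and not `η`.
  refine ⟨a * |α i - profile P i|, by positivity, fun ε hε =>
    ⟨K * (1 / ε) ^ a, by positivity, ?_⟩⟩
  filter_upwards [hup, eventually_gt_atTop 0] with n hn hn0
  have hn' : (0 : ℝ) < n := Nat.cast_pos.2 hn0
  have hlog : 0 ≤ Real.log n := Real.log_nonneg (Nat.one_le_cast.2 hn0)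
  have h := hn (1 / ε * (n : ℝ) ^ (-|α i - profile P i|)) _ (measurableSet_window α ε n) ?_
    (by positivity)
  · refine h.trans_eq ?_
    rw [Real.mul_rpow (by positivity) (by positivity), ← Real.rpow_mul hn'.le,
      show -|α i - profile P i| * a = -(a * |α i - profile P i|) by ring, ← mul_assoc K]
  · intro h hh _
    have h1 := abs_log_sub_le_of_mem hn0 hε (Set.mem_univ_pi.1 hh i)
    have h2 : |α i - profile P i| * Real.log n + Real.log ε ≤
        |Real.log (h i) - profile P i * Real.log n| := by
      have h3 := abs_sub_le (α i * Real.log n) (Real.log (h i)) (profile P i * Real.log n)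
      rw [← sub_mul, abs_mul, abs_of_nonneg hlog, abs_sub_comm (α i * Real.log n)] at h3
      linarith
    refine (exp_neg_sum_abs_le h2).trans_eq ?_
    rw [neg_add, Real.exp_add, Real.exp_neg (Real.log ε), Real.exp_log hε, Real.rpow_def_of_pos hn']
    ring_nf

/-- The optimal windows carry everything but a fraction that vanishes with `ε`. -/
theorem exists_motifProbOn_window_compl_le {τ hmin : ℝ} (hτ : 2 < τ) (hmin_pos : 0 < hmin) {k : ℕ}
    {H : SimpleGraph (Fin k)} {P : VertexPartition k} (hopt : IsOptimal τ H P)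
    (huniq : ∀ Q, IsOptimal τ H Q → Q = P) :
    ∃ a K : ℝ, 0 < a ∧ 0 < K ∧ ∀ ε : ℝ, 0 < ε → ∀ᶠ n : ℕ in atTop,
      motifProbOn τ hmin H n (window (profile P) ε n)ᶜ ≤
        K * ε ^ a * (n : ℝ) ^ (growthExponent τ H - k) := by
  obtain ⟨a, K, ha, hK, hup⟩ := exists_motifProbOn_le hτ hmin_pos hopt huniq
  refine ⟨a, K, ha, hK, fun ε hε => ?_⟩
  filter_upwards [hup, eventually_gt_atTop 0] with n hn hn0
  refine hn ε _ (measurableSet_window _ ε n).compl (fun h hh hpos => ?_) hε.le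
  obtain ⟨i, hi⟩ : ∃ i, h i ∉ Set.Icc (ε * (n : ℝ) ^ profile P i) (1 / ε * (n : ℝ) ^ profile P i) := by
    by_contra! hall
    exact hh (Set.mem_univ_pi.2 hall)
  refine (exp_neg_sum_abs_le
    (le_abs_log_sub_of_notMem hn0 hε (hmin_pos.trans_le (hpos i)) hi)).trans_eq ?_
  rw [neg_neg, Real.exp_log hε]

/-- The order of the probability of the motif. -/
theorem exists_motifProbOn_univ_order {τ hmin : ℝ} (hτ : 2 < τ) (hmin_pos : 0 < hmin) {k : ℕ}
    {H : SimpleGraph (Fin k)} {P : VertexPartition k} (hopt : IsOptimal τ H P)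
    (huniq : ∀ Q, IsOptimal τ H Q → Q = P) :
    ∃ c C : ℝ, 0 < c ∧ 0 < C ∧ ∀ᶠ n : ℕ in atTop,
      c * (n : ℝ) ^ (growthExponent τ H - k) ≤ motifProbOn τ hmin H n Set.univ ∧
        motifProbOn τ hmin H n Set.univ ≤ C * (n : ℝ) ^ (growthExponent τ H - k) := by
  obtain ⟨a, K, -, hK, hup⟩ := exists_motifProbOn_le hτ hmin_pos hopt huniq
  obtain ⟨ε₁, hε₁⟩ := exists_admissible hmin_pos P
  obtain ⟨c, hc, hlow⟩ := exists_le_motifProbOn_window hτ hmin_pos hopt hε₁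
  refine ⟨c, K, hc, hK, ?_⟩
  filter_upwards [hlow, hup] with n h1 h2
  refine ⟨h1.trans (motifProbOn_mono hτ hmin_pos H n (Set.subset_univ _)), ?_⟩
  refine (h2 1 _ MeasurableSet.univ (fun h _ _ => ?_) zero_le_one).trans_eq (by simp)
  rw [Real.exp_le_one_iff, neg_nonpos]
  exact Finset.sum_nonneg fun i _ => abs_nonneg _

/-! ### From probabilities to expected counts -/

lemma eventually_descFactorial_bounds (k : ℕ) : ∀ᶠ n : ℕ in atTop,
    1 / 2 * (n : ℝ) ^ k ≤ n.descFactorial k ∧ (n.descFactorial k : ℝ) ≤ (n : ℝ) ^ k := by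
  have h1 : Tendsto (fun n : ℕ => (n.descFactorial k : ℝ) / (n : ℝ) ^ k) atTop (nhds 1) :=
    (isEquivalent_iff_tendsto_one (by
      filter_upwards [eventually_gt_atTop 0] with n hn
      positivity)).1 (isEquivalent_descFactorial k)
  filter_upwards [h1.eventually_const_le (show (1 / 2 : ℝ) < 1 by norm_num),
    eventually_gt_atTop 0] with n hn hn0
  have hn' : (0 : ℝ) < (n : ℝ) ^ k := by positivity
  exact ⟨(le_div_iff₀ hn').1 hn, by exact_mod_cast Nat.descFactorial_le_pow n k⟩

lemma pow_mul_rpow_sub {n : ℕ} (hn : 0 < n) (k : ℕ) (e : ℝ) :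
    (n : ℝ) ^ k * (n : ℝ) ^ (e - k) = (n : ℝ) ^ e := by
  have hn' : (0 : ℝ) < n := Nat.cast_pos.2 hn
  rw [← Real.rpow_natCast, ← Real.rpow_add hn']
  ring_nf

/-- Bounds on probabilities turn into bounds on expected counts. -/
lemma descFactorial_mul_bounds {n k : ℕ} (hn : 0 < n)
    (hd : 1 / 2 * (n : ℝ) ^ k ≤ n.descFactorial k ∧ (n.descFactorial k : ℝ) ≤ (n : ℝ) ^ k)
    {c C e p : ℝ} (hc : 0 ≤ c) (h1 : c * (n : ℝ) ^ (e - k) ≤ p) (h2 : p ≤ C * (n : ℝ) ^ (e - k)) :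
    c / 2 * (n : ℝ) ^ e ≤ n.descFactorial k * p ∧
      n.descFactorial k * p ≤ C * (n : ℝ) ^ e := by
  have hp : 0 ≤ p := le_trans (by positivity) h1
  rw [← pow_mul_rpow_sub hn k e]
  constructor
  · refine le_trans (le_of_eq (by ring)) (mul_le_mul hd.1 h1 (by positivity) (by positivity))
  · refine (mul_le_mul hd.2 h2 hp (by positivity)).trans_eq (by ring)

end HiddenVariable

end

theorem theorem1 (τ hmin : ℝ) (hτ : 2 < τ) (hτ' : τ < 3) (hmin_pos : 0 < hmin)
    (k : ℕ) (H : SimpleGraph (Fin k))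
    (P : HiddenVariable.VertexPartition k) (hopt : HiddenVariable.IsOptimal τ H P)
    (huniq : ∀ Q : HiddenVariable.VertexPartition k, HiddenVariable.IsOptimal τ H Q → Q = P) :
    -- `E[N(H)] ~ n^k P(H)`
    (HiddenVariable.expCount τ hmin H ~[atTop]
      fun n : ℕ => (n : ℝ) ^ k * HiddenVariable.motifProb τ hmin H n) ∧
    -- `E[N(H)]` is of exact order `n^{(3-τ)k/2 + (τ-1)B_f(H)/2}`
    (HiddenVariable.expCount τ hmin H =Θ[atTop]
      fun n : ℕ => (n : ℝ) ^ HiddenVariable.growthExponent τ H) ∧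
    -- so is the contribution of the optimal profile, up to a factor `f(ε)`
    (∃ (f : ℝ → ℝ) (c C : ℝ), 0 < c ∧ 0 < C ∧
      ∀ ε : ℝ, HiddenVariable.Admissible hmin P ε → 0 < f ε ∧
        ∀ᶠ n : ℕ in atTop,
          c * f ε ≤ HiddenVariable.expWindowCount τ hmin H (HiddenVariable.profile P) ε n /
              (n : ℝ) ^ HiddenVariable.growthExponent τ H ∧
          HiddenVariable.expWindowCount τ hmin H (HiddenVariable.profile P) ε n /
              (n : ℝ) ^ HiddenVariable.growthExponent τ H ≤ C * f ε) ∧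
    -- every other profile is negligible by a polynomial factor
    (∀ α : Fin k → ℝ, α ≠ HiddenVariable.profile P → ∃ η : ℝ, 0 < η ∧
      ∀ ε : ℝ, HiddenVariable.Admissible hmin P ε →
        (fun n : ℕ => HiddenVariable.expWindowCount τ hmin H α ε n /
            HiddenVariable.expWindowCount τ hmin H (HiddenVariable.profile P) ε n)
          =O[atTop] fun n : ℕ => (n : ℝ) ^ (-η)) ∧
    -- the windows of the optimal profile carry the whole leading order as `ε → 0`
    (∀ δ : ℝ, 0 < δ → ∃ ε₀ : ℝ, 0 < ε₀ ∧ ε₀ < 1 ∧ ∀ ε : ℝ, 0 < ε → ε < ε₀ →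
      ∀ᶠ n : ℕ in atTop,
        (1 - δ) * HiddenVariable.expCount τ hmin H n ≤
          HiddenVariable.expWindowCount τ hmin H (HiddenVariable.profile P) ε n) := by
  open HiddenVariable in
  refine ⟨?_, ?_, ?_, ?_, ?_⟩
  · refine ((isEquivalent_descFactorial k).mul (IsEquivalent.refl (u := motifProb τ hmin H))).congr_left
      (Eventually.of_forall fun n => ?_)
    simp only [Pi.mul_apply]
    rw [expCount_eq hτ hmin_pos, motifProb_eq]
  · obtain ⟨c, C, hc, hC, hev⟩ := exists_motifProbOn_univ_order hτ hmin_pos hopt huniq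
    have hb : ∀ᶠ n : ℕ in atTop, c / 2 * (n : ℝ) ^ growthExponent τ H ≤ expCount τ hmin H n ∧
        expCount τ hmin H n ≤ C * (n : ℝ) ^ growthExponent τ H := by
      filter_upwards [hev, eventually_descFactorial_bounds k, eventually_gt_atTop 0] with n hn hd hn0
      rw [expCount_eq hτ hmin_pos]
      exact descFactorial_mul_bounds hn0 hd hc.le hn.1 hn.2
    constructor
    · refine IsBigO.of_bound C ?_
      filter_upwards [hb] with n hn
      have hr : (0 : ℝ) ≤ (n : ℝ) ^ growthExponent τ H := by positivity
      rw [Real.norm_of_nonneg hr, Real.norm_of_nonneg (le_trans (by positivity) hn.1)]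
      exact hn.2
    · refine IsBigO.of_bound (c / 2)⁻¹ ?_
      filter_upwards [hb] with n hn
      have hr : (0 : ℝ) ≤ (n : ℝ) ^ growthExponent τ H := by positivity
      rw [Real.norm_of_nonneg hr, Real.norm_of_nonneg (le_trans (by positivity) hn.1),
        le_inv_mul_iff₀ (by positivity)]
      exact hn.1
  · obtain ⟨f, c, C, hc, hC, hf⟩ := exists_motifProbOn_window_order hτ hmin_pos hopt huniq
    refine ⟨f, c / 2, C, by positivity, hC, fun ε hε => ⟨(hf ε hε).1, ?_⟩⟩
    have hfε := (hf ε hε).1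
    filter_upwards [(hf ε hε).2, eventually_descFactorial_bounds k, eventually_gt_atTop 0]
      with n hn hd hn0
    have hn' : (0 : ℝ) < n := Nat.cast_pos.2 hn0
    have := descFactorial_mul_bounds hn0 hd (by positivity) hn.1 hn.2
    rw [expWindowCount_eq hτ hmin_pos, le_div_iff₀ (by positivity), div_le_iff₀ (by positivity)]
    exact ⟨le_trans (le_of_eq (by ring)) this.1, this.2⟩
  · intro α hα
    obtain ⟨η, hη, hK⟩ := exists_motifProbOn_window_le hτ hmin_pos hopt huniq hα
    refine ⟨η, hη, fun ε hε => ?_⟩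
    obtain ⟨K, hK0, hup⟩ := hK ε hε.1
    obtain ⟨c, hc, hlow⟩ := exists_le_motifProbOn_window hτ hmin_pos hopt hε
    refine IsBigO.of_bound (K / c) ?_
    -- For `n ≥ k` the falling factorial is nonzero and cancels in the ratio.
    filter_upwards [hup, hlow, eventually_ge_atTop k, eventually_gt_atTop 0] with n h1 h2 hnk hn0
    have hn' : (0 : ℝ) < n := Nat.cast_pos.2 hn0
    have hd : (n.descFactorial k : ℝ) ≠ 0 :=
      Nat.cast_ne_zero.2 (mt Nat.descFactorial_eq_zero_iff_lt.1 (not_lt.2 hnk))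
    have h0 : 0 ≤ motifProbOn τ hmin H n (window α ε n) := by
      have := motifProbOn_mono hτ hmin_pos H n (Set.empty_subset (window α ε n))
      simpa [motifProbOn] using this
    have hden : 0 < motifProbOn τ hmin H n (window (profile P) ε n) :=
      lt_of_lt_of_le (by positivity) h2
    rw [expWindowCount_eq hτ hmin_pos, expWindowCount_eq hτ hmin_pos, mul_div_mul_left _ _ hd,
      Real.norm_of_nonneg (by positivity), Real.norm_of_nonneg (by positivity), div_le_iff₀ hden]
    calc _ ≤ K * (n : ℝ) ^ (-η) * (n : ℝ) ^ (growthExponent τ H - k) := h1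
      _ = K / c * (n : ℝ) ^ (-η) * (c * (n : ℝ) ^ (growthExponent τ H - k)) := by field_simp
      _ ≤ _ := mul_le_mul_of_nonneg_left h2 (by positivity)
  · intro δ hδ
    obtain ⟨a, K, ha, hK, hcompl⟩ := exists_motifProbOn_window_compl_le hτ hmin_pos hopt huniq
    obtain ⟨c, C, hc, hC, hev⟩ := exists_motifProbOn_univ_order hτ hmin_pos hopt huniq
    -- Chosen so that the mass outside the window, at most `K * ε ^ a` in units of the leading
    -- order, is at most `δ` times the lower bound `c` of the total. The bound on the complement
    -- holds for all `ε > 0`, so admissibility plays no role.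
    refine ⟨min (1 / 2) ((δ * c / K) ^ a⁻¹), by positivity,
      (min_le_left _ _).trans_lt (by norm_num), fun ε hε hlt => ?_⟩
    have hεa : K * ε ^ a ≤ δ * c := by
      have := Real.rpow_le_rpow hε.le (hlt.le.trans (min_le_right _ _)) ha.le
      rw [Real.rpow_inv_rpow (by positivity) ha.ne', le_div_iff₀ hK] at this
      linarith
    filter_upwards [hcompl ε hε, hev] with n h1 h2
    rw [expCount_eq hτ hmin_pos, expWindowCount_eq hτ hmin_pos, mul_left_comm]
    refine mul_le_mul_of_nonneg_left ?_ (Nat.cast_nonneg _)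
    have h3 := motifProbOn_compl hτ hmin_pos H n (measurableSet_window (profile P) ε n)
    have h4 : K * ε ^ a * (n : ℝ) ^ (growthExponent τ H - k) ≤
        δ * (c * (n : ℝ) ^ (growthExponent τ H - k)) := by
      rw [← mul_assoc]
      exact mul_le_mul_of_nonneg_right hεa (by positivity)
    have h5 := mul_le_mul_of_nonneg_left h2.1 hδ.le
    linarith
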